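/- Let $\mathbb K$ be a field, $\lambda\in\mathbb K$, and let $(A,\cdot)$ be an associative (not necessarily unital) $\mathbb K$-algebra. Let $A\oplus_M A$ be the quasi-twilled associative algebra $(A\oplus A,A,A)$ with associative multiplication $$\Omega\big((x,u),(y,v)\big)=(x\cdot v+u\cdot y,\ \lambda\,x\cdot y+u\cdot v),$$ whose second summand is a subalgebra. Place $\mathrm{Hom}(\otimes^{n+1}V,W)$ in degree $n$. Let $[\cdot,\cdot]_G$ be the Gerstenhaber bracket on $\bigoplus_{n\ge0}\mathrm{Hom}(\otimes^{n+1}(A\oplus A),A\oplus A)$, that is, for $f$ of arity $m$ and $g$ of arity $n$, $[f,g]_G=f\circ g-(-1)^{(m-1)(n-1)}g\circ f$ with $$f\circ g(x_1,\dots,x_{m+n-1})=\sum_{i=1}^m(-1)^{(i-1)(n-1)}f(x_1,\dots,x_{i-1},g(x_i,\dots,x_{i+n-1}),x_{i+n},\dots,x_{m+n-1}).$$ Regard $F=\bigoplus_{n\ge 0}\mathrm{Hom}(\otimes^{n+1}A,A)$ as the subspace of those cochains that depend only on the first-summand components of their arguments and take values in the second summand, and let $P$ be the projection onto $F$ that restricts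 the arguments to the first summand and takes the second component of the value. Set $l_0=P\Omega$ and $l_k(f_1,\dots,f_k)=P[\cdots[[\Omega,f_1]_G,f_2]_G,\cdots,f_k]_G$ for $k\ge1$, $f_i\in F$. Then $(F,\{l_k\}_{k\ge 0})$ is a curved $L_\infty$-algebra: the $l_k$ have degree $1$, are graded symmetric, $l_k(x_{\sigma(1)},\dots,x_{\sigma(k)})=\varepsilon(\sigma)l_k(x_1,\dots,x_k)$, and satisfy, for all $n\ge0$ and homogeneous $x_1,\dots,x_n$, $$\sum_{i=0}^n\sum_{\sigma\in S(i,n-i)}\varepsilon(\sigma)\,l_{n-i+1}\big(l_i(x_{\sigma(1)},\dots,x_{\sigma(i)}),x_{\sigma(i+1)},\dots,x_{\sigma(n)}\big)=0,$$ where $S(i,n-i)$ is the set of $(i,n-i)$-shuffles and $\varepsilon(\sigma)$ is the Koszul sign. Moreover $l_0(x,y)=\lambda\,x\cdot y$, $l_1=0$, $l_k=0$ for $k\ge3$, and for $f\in\mathrm{Hom}(\otimes^mA,A)$, $g\in\mathrm{Hom}(\otimes^nA,A)$ with $m,n\ge1$, \begin{align*} l_2(f,g)&(x_1,\dots,x_{m+n})\\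 ={}&(-1)^{m-1}g(x_1,\dots,x_n)\cdot f(x_{n+1},\dots,x_{m+n})+(-1)^{m(n-1)}f(x_1,\dots,x_m)\cdot g(x_{m+1},\dots,x_{m+n})\\ &-\sum_{i=1}^m(-1)^{in}(-1)^m f(x_1,\dots,x_{i-1},x_i\cdot g(x_{i+1},\dots,x_{i+n}),x_{i+n+1},\dots,x_{m+n})\\ &+\sum_{i=1}^m(-1)^{(i-1)n}(-1)^m f(x_1,\dots,x_{i-1},g(x_i,\dots,x_{i+n-1})\cdot x_{i+n},x_{i+n+1},\dots,x_{m+n})\\ &-\sum_{i=1}^n(-1)^{(i-1)m}(-1)^{m(n-1)}g(x_1,\dots,x_{i-1},f(x_i,\dots,x_{i+m-1})\cdot x_{i+m},x_{i+m+1},\dots,x_{m+n})\\ &+\sum_{i=1}^n(-1)^{(i-1)m}(-1)^{mn}g(x_1,\dots,x_{i-1},x_i\cdot f(x_{i+1},\dots,x_{i+m}),x_{i+m+1},\dots,x_{m+n}). \end{align*} If the characteristic of $\mathbb K$ is not $2$, then the Maurer-Cartan elements of this curved $L_\infty$-algebra, i.e. the degree $0$ elements $D$ with $l_0+\sum_{k\ge1}\frac1{k!}l_k(D,\dots,D)=0$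 (where only $l_0+\frac12l_2(D,D)$ can be nonzero), are exactly the modified Rota-Baxter operators of weight $\lambda$ on $A$, i.e. the linear maps $D:A\to A$ with $$D(x)\cdot D(y)-D(x\cdot D(y))-D(D(x)\cdot y)=-\lambda\,x\cdot y\qquad\text{for all }x,y\in A.$$ -/

import Mathlib

set_option maxSynthPendingDepth 3

open scoped DirectSum

noncomputable section

/-! ## Curved `L_∞`-algebras -/

section CurvedLInfty

/-- The Koszul sign `ε(σ; x_1, …, x_n)` for elements `x_a` of degree `d a`: the product of
`(-1)^{|x_{σ(a)}| |x_{σ(b)}|}` over all inversions `a < b`, `σ(b) < σ(a)`. -/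
def koszulSign {n : ℕ} (d : Fin n → ℤ) (σ : Equiv.Perm (Fin n)) : ℤ :=
  ∏ p ∈ Finset.univ.filter (fun p : Fin n × Fin n => p.1 < p.2 ∧ σ p.2 < σ p.1),
    ((d (σ p.1) * d (σ p.2)).negOnePow : ℤ)

/-- `(i, n-i)`-shuffles: `σ(1) < ⋯ < σ(i)` and `σ(i+1) < ⋯ < σ(n)`. -/
def shuffles (n i : ℕ) : Finset (Equiv.Perm (Fin n)) :=
  Finset.univ.filter (fun σ => ∀ a b : Fin n, a < b → (b.val < i ∨ i ≤ a.val) → σ a < σ b)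

variable {K : Type*} [Field K] {g : Type*} [AddCommGroup g] [Module K g]

/-- A curved `L_∞`-algebra: a `ℤ`-graded vector space `g = ⨁ 𝒢 k` with operations
`l k : ⊗^k g → g` of degree `1` that are graded symmetric and satisfy the generalized
Jacobi identities for all `n ≥ 0`. -/
structure IsCurvedLInfty (𝒢 : ℤ → Submodule K g)
    (l : ∀ k : ℕ, MultilinearMap K (fun _ : Fin k => g) g) : Prop where
  graded : DirectSum.IsInternal 𝒢
  degree_one : ∀ (n : ℕ) (d : Fin n → ℤ) (x : Fin n → g), (∀ a, x a ∈ 𝒢 (d a)) →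
    l n x ∈ 𝒢 (∑ a, d a + 1)
  symm : ∀ (n : ℕ) (d : Fin n → ℤ) (x : Fin n → g), (∀ a, x a ∈ 𝒢 (d a)) →
    ∀ σ : Equiv.Perm (Fin n), l n (fun a => x (σ a)) = koszulSign d σ • l n x
  jacobi : ∀ (n : ℕ) (d : Fin n → ℤ) (x : Fin n → g), (∀ a, x a ∈ 𝒢 (d a)) →
    ∑ i : Fin (n + 1), ∑ σ ∈ shuffles n i,
      koszulSign d σ •
        l (n - i + 1) (Fin.cons (α := fun _ => g)
          (l i (fun a : Fin i => x (σ ⟨a, by omega⟩)))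
          (fun b : Fin (n - i) => x (σ ⟨i + b, by omega⟩))) = 0

/-- A Maurer-Cartan element: a degree `0` element `x` with
`l_0 + ∑_{k ≥ 1} (1/k!) l_k(x, …, x) = 0`, the sum having only finitely many nonzero terms. -/
def IsMaurerCartan (𝒢 : ℤ → Submodule K g)
    (l : ∀ k : ℕ, MultilinearMap K (fun _ : Fin k => g) g) (x : g) : Prop :=
  x ∈ 𝒢 0 ∧
  (Function.support
    (fun k : ℕ => (((k + 1).factorial : K)⁻¹) • l (k + 1) (fun _ => x))).Finite ∧
  l 0 ![] + ∑ᶠ k : ℕ, (((k + 1).factorial : K)⁻¹) • l (k + 1) (fun _ => x) = 0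

end CurvedLInfty

/-! ## Cochains and the Gerstenhaber bracket -/

section Cochains

variable (K : Type*) [Field K]
variable (V : Type*) [AddCommGroup V] [Module K V] (W : Type*) [AddCommGroup W] [Module K W]

/-- `Hom(⊗^{n+1} V, W)`, placed in degree `n`. -/
abbrev Cochain (n : ℕ) : Type _ := MultilinearMap K (fun _ : Fin (n + 1) => V) W

/-- `⨁_{n ≥ 0} Hom(⊗^{n+1} V, W)`. -/
abbrev Cochains : Type _ := ⨁ n : ℕ, Cochain K V W n

/-- The `ℤ`-grading of `⨁_{n ≥ 0} Hom(⊗^{n+1} V, W)`: the degree `k` part consists of the elements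
all of whose components outside degree `k` vanish (so it is zero for `k < 0`). -/
def cochainGrading (k : ℤ) : Submodule K (Cochains K V W) where
  carrier := {x | ∀ n : ℕ, (n : ℤ) ≠ k → x n = 0}
  zero_mem' := fun n _ => DirectSum.zero_apply n
  add_mem' := fun {x y} hx hy n hn => by
    rw [DirectSum.add_apply, hx n hn, hy n hn, add_zero]
  smul_mem' := fun c x hx n hn => by
    rw [DirectSum.smul_apply, hx n hn, smul_zero]

variable {V}

/-- The arguments `(x_1, …, x_{i-1}, g(x_i, …, x_{i+n}), x_{i+n+1}, …)` of `f` in a term of `f ∘ g`;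
here positions are counted from `0`, so `i` stands for the mathematical `i - 1`. -/
def insertArgs {m n : ℕ} (i : Fin (m + 1)) (g : (Fin (n + 1) → V) → V)
    (x : Fin (m + n + 1) → V) : Fin (m + 1) → V := fun j =>
  if j < i then x ⟨j, by omega⟩
  else if j = i then g (fun k => x ⟨i + k, by omega⟩)
  else x ⟨j + n, by omega⟩

variable {K}

theorem insertArgs_update {m n : ℕ} (i : Fin (m + 1)) (g : Cochain K V V n)
    (x : Fin (m + n + 1) → V) (p : Fin (m + n + 1)) :
    ∃ (q : Fin (m + 1)) (T : V →ₗ[K] V), ∀ v,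
      insertArgs i g (Function.update x p v)
        = Function.update (insertArgs i g x) q (T v) := by
  rcases lt_or_ge p.val i.val with h1 | h1
  · refine ⟨⟨p, by omega⟩, LinearMap.id, fun v => ?_⟩
    funext j
    by_cases hj : j = ⟨p, by omega⟩
    · subst hj
      have : (⟨p, by omega⟩ : Fin (m + 1)) < i := h1
      simp [insertArgs, this]
    · have hj' : j.val ≠ p.val := fun h => hj (Fin.ext h)
      rw [Function.update_of_ne hj]
      unfold insertArgs
      split_ifs with h2 h3
      · rw [Function.update_of_ne]; simpa [Fin.ext_iff] using hj'
      · congr 1; funext k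
        rw [Function.update_of_ne]; simp only [ne_eq, Fin.ext_iff]; omega
      · rw [Function.update_of_ne]
        simp only [ne_eq, Fin.ext_iff]; simp only [Fin.lt_def, Fin.ext_iff] at h2 h3; omega
  · rcases le_or_gt p.val (i.val + n) with h4 | h4
    · refine ⟨i, g.toLinearMap (fun k => x ⟨i + k, by omega⟩) ⟨p - i, by omega⟩, fun v => ?_⟩
      funext j
      by_cases hj : j = i
      · subst hj
        simp only [insertArgs, lt_irrefl, if_false, if_true, Function.update_self,
          MultilinearMap.toLinearMap_apply]
        congr 1; funext k
        by_cases hk : k = ⟨p - j, by omega⟩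
        · subst hk
          rw [Function.update_self]
          have : (⟨j + (p - j), by omega⟩ : Fin (m + n + 1)) = p := by
            apply Fin.ext; simp only; omega
          simp [this]
        · rw [Function.update_of_ne hk, Function.update_of_ne]
          simp only [Fin.ext_iff, ne_eq] at hk ⊢; omega
      · rw [Function.update_of_ne hj]
        unfold insertArgs
        split_ifs with h2
        · rw [Function.update_of_ne]
          simp only [ne_eq, Fin.ext_iff]; simp only [Fin.lt_def] at h2; omega
        · rw [Function.update_of_ne]
          simp only [ne_eq, Fin.ext_iff]; simp only [Fin.lt_def, Fin.ext_iff] at h2 hj; omega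
    · refine ⟨⟨p - n, by omega⟩, LinearMap.id, fun v => ?_⟩
      funext j
      by_cases hj : j = ⟨p - n, by omega⟩
      · subst hj
        have h5 : ¬ (⟨p - n, by omega⟩ : Fin (m + 1)) < i := by
          simp only [Fin.lt_def]; omega
        have h6 : ¬ (⟨p - n, by omega⟩ : Fin (m + 1)) = i := by
          simp only [Fin.ext_iff]; omega
        have h7 : (⟨p - n + n, by omega⟩ : Fin (m + n + 1)) = p := by
          apply Fin.ext; simp only; omega
        simp [insertArgs, h5, h6, h7]
      · rw [Function.update_of_ne hj]
        simp only [Fin.ext_iff] at hj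
        unfold insertArgs
        split_ifs with h2 h3
        · rw [Function.update_of_ne]
          simp only [ne_eq, Fin.ext_iff]; simp only [Fin.lt_def] at h2; omega
        · congr 1; funext k
          rw [Function.update_of_ne]; simp only [ne_eq, Fin.ext_iff]; omega
        · rw [Function.update_of_ne]
          simp only [ne_eq, Fin.ext_iff]; omega

/-- `(x_1, …) ↦ f(x_1, …, x_{i-1}, g(x_i, …, x_{i+n}), x_{i+n+1}, …)`. -/
def insertCochain {m n : ℕ} (i : Fin (m + 1)) (f : Cochain K V V m) (g : Cochain K V V n) :
    Cochain K V V (m + n) :=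
  MultilinearMap.mk' (fun x => f (insertArgs i g x))
    (fun x p v w => by
      obtain ⟨q, T, h⟩ := insertArgs_update i g x p
      rw [h, h, h, map_add, f.map_update_add])
    (fun x p c v => by
      obtain ⟨q, T, h⟩ := insertArgs_update i g x p
      rw [h, h, map_smul, f.map_update_smul])

theorem insertArgs_eq_update {X : Type*} {m n : ℕ} (i : Fin (m + 1)) (g g' : (Fin (n + 1) → X) → X)
    (x : Fin (m + n + 1) → X) :
    insertArgs i g x
      = Function.update (insertArgs i g' x) i (g (fun k => x ⟨i + k, by omega⟩)) := by
  funext j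
  by_cases hj : j = i
  · subst hj; simp [insertArgs]
  · simp [insertArgs, hj]

/-- The Gerstenhaber composition `f ∘ g` on homogeneous cochains, of degrees `m` and `n`, i.e.
`(f ∘ g)(x_1, …) = ∑_i (-1)^{(i-1) n} f(x_1, …, x_{i-1}, g(x_i, …, x_{i+n}), x_{i+n+1}, …)`. -/
def gerstenhaberComp (m n : ℕ) :
    Cochain K V V m →ₗ[K] Cochain K V V n →ₗ[K] Cochain K V V (m + n) :=
  LinearMap.mk₂ K
    (fun f g => ∑ i : Fin (m + 1), ((-1 : ℤ) ^ (i.val * n)) • insertCochain i f g)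
    (fun f f' g => by
      rw [← Finset.sum_add_distrib]
      refine Finset.sum_congr rfl fun i _ => ?_
      rw [← smul_add]; rfl)
    (fun c f g => by
      rw [Finset.smul_sum]
      refine Finset.sum_congr rfl fun i _ => ?_
      rw [smul_comm c]; rfl)
    (fun f g g' => by
      rw [← Finset.sum_add_distrib]
      refine Finset.sum_congr rfl fun i _ => ?_
      rw [← smul_add]; congr 1; ext x
      change f _ = f _ + f _
      rw [insertArgs_eq_update i _ (fun _ => 0), insertArgs_eq_update i g (fun _ => 0),
        insertArgs_eq_update i g' (fun _ => 0), ← f.map_update_add]; rfl)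
    (fun c f g => by
      rw [Finset.smul_sum]
      refine Finset.sum_congr rfl fun i _ => ?_
      rw [smul_comm c]; congr 1; ext x
      change f _ = c • f _
      rw [insertArgs_eq_update i _ (fun _ => 0), insertArgs_eq_update i g (fun _ => 0),
        ← f.map_update_smul]; rfl)

variable (K V)

/-- The Gerstenhaber bracket `[f, g]_G = f ∘ g - (-1)^{m n} g ∘ f` (for `f`, `g` of degrees
`m`, `n`), extended bilinearly to `⨁_{n ≥ 0} Hom(⊗^{n+1} V, V)`. -/
def gerstenhaberBracket : Cochains K V V →ₗ[K] Cochains K V V →ₗ[K] Cochains K V V :=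
  DirectSum.toModule K ℕ _ fun m =>
    LinearMap.flip <| DirectSum.toModule K ℕ _ fun n => LinearMap.flip <|
      (gerstenhaberComp m n).compr₂ (DirectSum.lof K ℕ (Cochain K V V) (m + n))
        - ((-1 : ℤ) ^ (m * n)) •
          ((gerstenhaberComp n m).compr₂ (DirectSum.lof K ℕ (Cochain K V V) (n + m))).flip

end Cochains

/-! ## Quasi-twilled associative algebras and their derived brackets -/

section QuasiTwilled

/-- A quasi-twilled associative algebra `(A ⊕ A', A, A')`: an associative multiplication on
`A ⊕ A'` for which `A'` is a subalgebra. -/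
structure QuasiTwilledAlgebra (K : Type*) [Field K] (A A' : Type*) [AddCommGroup A] [Module K A]
    [AddCommGroup A'] [Module K A'] where
  mul : (A × A') →ₗ[K] (A × A') →ₗ[K] (A × A')
  mul_assoc : ∀ a b c, mul (mul a b) c = mul a (mul b c)
  mul_right_mem : ∀ u v : A', (mul (0, u) (0, v)).1 = 0

variable {K : Type*} [Field K] {A A' : Type*} [AddCommGroup A] [Module K A]
    [AddCommGroup A'] [Module K A']

variable (K A A') in
/-- The inclusion of `⨁ Hom(⊗^{n+1} A, A')` into `⨁ Hom(⊗^{n+1} (A ⊕ A'), A ⊕ A')` by lifts: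
`f̂((x_1, u_1), …) = (0, f(x_1, …))`. -/
def cochainLift : Cochains K A A' →ₗ[K] Cochains K (A × A') (A × A') :=
  DirectSum.lmap fun n =>
    { toFun := fun f => (LinearMap.inr K A A').compMultilinearMap
        (f.compLinearMap fun _ => LinearMap.fst K A A')
      map_add' := fun f f' => by ext x <;> simp
      map_smul' := fun c f => by ext x <;> simp }

variable (K A A') in
/-- The projection of `⨁ Hom(⊗^{n+1} (A ⊕ A'), A ⊕ A')` onto `⨁ Hom(⊗^{n+1} A, A')`: restrict the
arguments to `A` and take the `A'`-component of the value. -/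
def cochainProj : Cochains K (A × A') (A × A') →ₗ[K] Cochains K A A' :=
  DirectSum.lmap fun n =>
    { toFun := fun h => (LinearMap.snd K A A').compMultilinearMap
        (h.compLinearMap fun _ => LinearMap.inl K A A')
      map_add' := fun f f' => by ext x; simp
      map_smul' := fun c f => by ext x; simp }

namespace QuasiTwilledAlgebra

/-- The multiplication `Ω` of a quasi-twilled algebra, as an element of degree `1` of
`⨁ Hom(⊗^{n+1} (A ⊕ A'), A ⊕ A')`. -/
def delta (Q : QuasiTwilledAlgebra K A A') : Cochains K (A × A') (A × A') :=
  DirectSum.lof K ℕ (Cochain K (A × A') (A × A')) 1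
    (MultilinearMap.mk' (fun x => Q.mul (x 0) (x 1))
      (fun x p v w => by fin_cases p <;> simp)
      (fun x p c v => by fin_cases p <;> simp))

/-- The iterated bracket `(x_1, …, x_k) ↦ [⋯[[Ω, x_1]_G, x_2]_G, ⋯, x_k]_G`. -/
def iteratedBracket (Q : QuasiTwilledAlgebra K A A') : ∀ k : ℕ,
    MultilinearMap K (fun _ : Fin k => Cochains K A A') (Cochains K (A × A') (A × A'))
  | 0 => MultilinearMap.constOfIsEmpty K _ Q.delta
  | k + 1 => MultilinearMap.uncurryRight
      (((gerstenhaberBracket K (A × A')).compl₂ (cochainLift K A A')).compMultilinearMap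
        (iteratedBracket Q k))

/-- The derived brackets `l_k(x_1, …, x_k) = P [⋯[[Ω, x_1]_G, x_2]_G, ⋯, x_k]_G` (with
`l_0 = P Ω`) on `⨁ Hom(⊗^{n+1} A, A')`. -/
def derivedBracket (Q : QuasiTwilledAlgebra K A A') (k : ℕ) :
    MultilinearMap K (fun _ : Fin k => Cochains K A A') (Cochains K A A') :=
  (cochainProj K A A').compMultilinearMap (Q.iteratedBracket k)

end QuasiTwilledAlgebra

end QuasiTwilled

/-! ## Modified Rota-Baxter operators -/

section ModifiedRotaBaxter

variable {K : Type*} [Field K] {A : Type*} [NonUnitalRing A] [Module K A]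

/-- `D(x) D(y) - D(x D(y)) - D(D(x) y) = -λ x y`. -/
def IsModifiedRotaBaxter (lam : K) (D : A →ₗ[K] A) : Prop :=
  ∀ x y : A, D x * D y - D (x * D y) - D (D x * y) = -(lam • (x * y))

variable [IsScalarTower K A A] [SMulCommClass K A A]

variable (A) in
/-- The quasi-twilled associative algebra `A ⊕_M A`, with multiplication
`(x, u) (y, v) = (x v + u y, λ x y + u v)`. -/
def sumM (lam : K) : QuasiTwilledAlgebra K A A where
  mul := LinearMap.mk₂ K
    (fun a b => (a.1 * b.2 + a.2 * b.1, lam • (a.1 * b.1) + a.2 * b.2))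
    (fun a a' b => by
      ext <;> simp only [Prod.fst_add, Prod.snd_add, add_mul, smul_add] <;> abel)
    (fun c a b => by
      ext <;> simp only [Prod.smul_fst, Prod.smul_snd, smul_mul_assoc, smul_add,
        smul_comm c lam])
    (fun a b b' => by
      ext <;> simp only [Prod.fst_add, Prod.snd_add, mul_add, smul_add] <;> abel)
    (fun c a b => by
      ext <;> simp only [Prod.smul_fst, Prod.smul_snd, mul_smul_comm, smul_add,
        smul_comm c lam])
  mul_assoc a b c := by
    ext <;> simp only [LinearMap.mk₂_apply, add_mul, mul_add, smul_add, smul_mul_assoc,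
      mul_smul_comm, mul_assoc] <;> abel
  mul_right_mem u v := by simp

/-- The consecutive entries `(x_s, x_{s+1}, …, x_{s+n-1})` of a sequence. -/
def window (x : ℕ → A) (s n : ℕ) : Fin n → A := fun k => x (s + k)

/-- `(x_1, …, x_{i-1}, a, x_{i+r+1}, x_{i+r+2}, …)`, a tuple of length `m`. -/
def replaceBlock (x : ℕ → A) (i : ℕ) (a : A) (r m : ℕ) : Fin m → A := fun k =>
  if k.val + 1 < i then x (k + 1) else if k.val + 1 = i then a else x (k + 1 + r)

/-- The value at `(x_1, …, x_{m+n})` of the explicit binary bracket of `f ∈ Hom(⊗^m A, A)` and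
`g ∈ Hom(⊗^n A, A)`. -/
def explicitL2 {m n : ℕ} (f : (Fin m → A) → A) (g : (Fin n → A) → A) (x : ℕ → A) : A :=
  (-1 : ℤ) ^ (m - 1) • (g (window x 1 n) * f (window x (n + 1) m))
  + (-1 : ℤ) ^ (m * (n - 1)) • (f (window x 1 m) * g (window x (m + 1) n))
  - ∑ i ∈ Finset.Icc 1 m, ((-1 : ℤ) ^ (i * n) * (-1) ^ m) •
      f (replaceBlock x i (x i * g (window x (i + 1) n)) n m)
  + ∑ i ∈ Finset.Icc 1 m, ((-1 : ℤ) ^ ((i - 1) * n) * (-1) ^ m) •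
      f (replaceBlock x i (g (window x i n) * x (i + n)) n m)
  - ∑ i ∈ Finset.Icc 1 n, ((-1 : ℤ) ^ ((i - 1) * m) * (-1) ^ (m * (n - 1))) •
      g (replaceBlock x i (f (window x i m) * x (i + m)) m n)
  + ∑ i ∈ Finset.Icc 1 n, ((-1 : ℤ) ^ ((i - 1) * m) * (-1) ^ (m * n)) •
      g (replaceBlock x i (x i * f (window x (i + 1) m)) m n)

end ModifiedRotaBaxter

end

/-!
Inserting one cochain into another satisfies the graded pre-Lie identity, since in the associator
`(f ∘ g) ∘ h - f ∘ (g ∘ h)` only the insertions of `g` and `h` into different arguments of `f`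
survive; hence the Gerstenhaber bracket satisfies the graded Jacobi identity. If `g = h` has odd
degree, the surviving terms cancel in pairs, so `Ω ∘ Ω = 0`, the associativity of the product, gives
`[Ω, [Ω, y]] = 0` without dividing by `2`.

The inclusion `I` identifies `F` with an abelian subalgebra, and
`P[x, y] = P[I P x, y] + P[x, I P y]`. As the second summand is a subalgebra, `[[Ω, I f], I g]` is
again a lift, so it commutes with the lifts and the operations of arity at least `3` vanish. The
generalized Jacobi identities then reduce to the axioms of a curved differential graded Lie algebra
in the degree-shifted convention, and each of them is the image under `P` of an instance of the
Jacobi identity, of `[Ω, [Ω, y]] = 0`, or of `Ω ∘ Ω = 0`.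
-/

section PartialComposition

variable {X Y : Type*}

/-- The sequence `(s_0, …, s_{i-1}, v, s_{i+n+1}, s_{i+n+2}, …)`, in which `v` replaces a block of
`n + 1` entries. -/
def insertSeq (i n : ℕ) (v : X) (s : ℕ → X) : ℕ → X := fun k =>
  if k < i then s k else if k = i then v else s (k + n)

/-- The partial composition `F ∘_i G` of an operad of operations. Operations take sequences as
arguments, of which they read a finite initial segment; `n + 1` is the arity of `G`. -/
def partialComp (i n : ℕ) (F : (ℕ → X) → Y) (G : (ℕ → X) → X) (s : ℕ → X) : Y :=
  F (insertSeq i n (G fun k => s (i + k)) s)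

theorem insertSeq_add_apply_add (i k p t : ℕ) (w : X) (s : ℕ → X) :
    insertSeq (i + k) p w s (i + t) = insertSeq k p w (fun t => s (i + t)) t := by
  simp only [insertSeq, add_lt_add_iff_left, add_right_inj, add_assoc]

theorem insertSeq_insertSeq_of_le {k n : ℕ} (hk : k ≤ n) (i p : ℕ) (v w : X) (s : ℕ → X) :
    insertSeq i n v (insertSeq (i + k) p w s) = insertSeq i (n + p) v s := by
  funext t
  simp only [insertSeq]
  split_ifs <;> first | rfl | omega | (congr 1; omega)

theorem insertSeq_insertSeq_comm {i j : ℕ} (hji : j < i) (n p : ℕ) (v w : X) (s : ℕ → X) :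
    insertSeq i n v (insertSeq j p w s) = insertSeq j p w (insertSeq (i + p) n v s) := by
  funext t
  simp only [insertSeq]
  split_ifs <;> first | rfl | omega | (congr 1; omega)

theorem partialComp_sequential {k n : ℕ} (hk : k ≤ n) (i p : ℕ) (F : (ℕ → X) → Y)
    (G H : (ℕ → X) → X) :
    partialComp (i + k) p (partialComp i n F G) H
      = partialComp i (n + p) F (partialComp k p G H) := by
  funext s
  simp only [partialComp, insertSeq_add_apply_add, insertSeq_insertSeq_of_le hk, add_assoc]

theorem partialComp_parallel {i j : ℕ} (hji : j < i) (n : ℕ) {p : ℕ} (F : (ℕ → X) → Y)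
    (G : (ℕ → X) → X) {H : (ℕ → X) → X} (hH : DependsOn H (Set.Iic p)) :
    partialComp j p (partialComp i n F G) H
      = partialComp (i + p) n (partialComp j p F H) G := by
  funext s
  have inner_of_right (w : X) :
      (fun k => insertSeq j p w s (i + k)) = fun k => s (i + p + k) := by
    funext k
    simp only [insertSeq]
    rw [if_neg (by omega), if_neg (by omega), add_right_comm]
  have inner_of_left (v : X) :
      H (fun k => insertSeq (i + p) n v s (j + k)) = H fun k => s (j + k) :=
    hH fun k hk => if_pos (by have := Set.mem_Iic.1 hk; omega)
  simp only [partialComp, inner_of_right, inner_of_left, insertSeq_insertSeq_comm hji]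

end PartialComposition

section EvalSeq

variable {K : Type*} [Field K] {V : Type*} [AddCommGroup V] [Module K V]
  {W : Type*} [AddCommGroup W] [Module K W] {m n p : ℕ}

/-- The value of an `(n+1)`-ary cochain at the first `n + 1` entries of a sequence: arguments of
all arities are thus handled without casts between the types `Fin n`. -/
def evalSeq (f : Cochain K V W n) (s : ℕ → V) : W := f fun k => s k

theorem evalSeq_add (f g : Cochain K V W n) (s : ℕ → V) :
    evalSeq (f + g) s = evalSeq f s + evalSeq g s := rfl

theorem dependsOn_evalSeq (f : Cochain K V W n) : DependsOn (evalSeq f) (Set.Iic n) :=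
  fun _ _ h => congrArg f (funext fun k => h k (Nat.lt_succ_iff.1 k.2))

theorem evalSeq_injective : Function.Injective (evalSeq : Cochain K V W n → (ℕ → V) → W) := by
  intro f g h
  ext x
  have extend : (fun k : Fin (n + 1) => if hk : (k : ℕ) < n + 1 then x ⟨k, hk⟩ else 0) = x :=
    funext fun k => dif_pos k.2
  have := congrFun h fun k => if hk : k < n + 1 then x ⟨k, hk⟩ else 0
  rwa [evalSeq, evalSeq, extend] at this

theorem evalSeq_insertSeq {i : ℕ} (hi : i < m + 1) (n : ℕ) (f : Cochain K V W m) (v : V)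
    (s : ℕ → V) :
    evalSeq f (insertSeq i n v s)
      = f.toLinearMap (fun k => insertSeq i n 0 s k) ⟨i, hi⟩ v := by
  rw [MultilinearMap.toLinearMap_apply, evalSeq]
  congr 1
  funext k
  rcases eq_or_ne k ⟨i, hi⟩ with rfl | hk
  · simp [insertSeq]
  · have : (k : ℕ) ≠ i := fun h => hk (Fin.ext h)
    simp [insertSeq, hk, this]

theorem evalSeq_insertSeq_zero {i : ℕ} (hi : i < m + 1) (n : ℕ) (f : Cochain K V W m)
    (s : ℕ → V) : evalSeq f (insertSeq i n 0 s) = 0 := by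
  rw [evalSeq_insertSeq hi, map_zero]

theorem evalSeq_insertSeq_add {i : ℕ} (hi : i < m + 1) (n : ℕ) (f : Cochain K V W m) (v w : V)
    (s : ℕ → V) :
    evalSeq f (insertSeq i n (v + w) s)
      = evalSeq f (insertSeq i n v s) + evalSeq f (insertSeq i n w s) := by
  simp only [evalSeq_insertSeq hi, map_add]

theorem evalSeq_insertSeq_sum {i : ℕ} (hi : i < m + 1) (n : ℕ) (f : Cochain K V W m) {ι : Type*}
    (S : Finset ι) (c : ι → ℤ) (v : ι → V) (s : ℕ → V) :
    evalSeq f (insertSeq i n (∑ k ∈ S, c k • v k) s)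
      = ∑ k ∈ S, c k • evalSeq f (insertSeq i n (v k) s) := by
  simp only [evalSeq_insertSeq hi, map_sum, map_zsmul]

theorem evalSeq_insertCochain (i : Fin (m + 1)) (f : Cochain K V V m) (g : Cochain K V V n) :
    evalSeq (insertCochain i f g) = partialComp i n (evalSeq f) (evalSeq g) := by
  funext s
  change f _ = f _
  congr 1
  funext j
  simp only [insertArgs, insertSeq, Fin.lt_def, Fin.ext_iff]
  rfl

/-- A bilinear map as a cochain of degree `1`. -/
def bilinearCochain (B : V →ₗ[K] V →ₗ[K] W) : Cochain K V W 1 :=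
  MultilinearMap.mk' (fun x => B (x 0) (x 1))
    (fun x p v w => by fin_cases p <;> simp)
    (fun x p c v => by fin_cases p <;> simp)

theorem evalSeq_bilinearCochain (B : V →ₗ[K] V →ₗ[K] W) (s : ℕ → V) :
    evalSeq (bilinearCochain B) s = B (s 0) (s 1) := rfl

theorem evalSeq_gerstenhaberComp (f : Cochain K V V m) (g : Cochain K V V n) (s : ℕ → V) :
    evalSeq (gerstenhaberComp m n f g) s = ∑ i ∈ Finset.range (m + 1),
      (-1 : ℤ) ^ (i * n) • partialComp i n (evalSeq f) (evalSeq g) s := by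
  rw [Finset.sum_range]
  simp only [← evalSeq_insertCochain]
  simp [gerstenhaberComp, evalSeq]

theorem evalSeq_bilinearCochain_gerstenhaberComp (B : V →ₗ[K] V →ₗ[K] V) (g : Cochain K V V n)
    (s : ℕ → V) :
    evalSeq (gerstenhaberComp 1 n (bilinearCochain B) g) s
      = B (evalSeq g s) (s (1 + n)) + (-1 : ℤ) ^ n • B (s 0) (evalSeq g fun k => s (1 + k)) := by
  rw [evalSeq_gerstenhaberComp, Finset.sum_range_succ, Finset.sum_range_one]
  simp [partialComp, evalSeq_bilinearCochain, insertSeq]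

end EvalSeq

section Associator

theorem sum_range_eq_left_add_middle_add_right {M : Type*} [AddCommMonoid M] {i m : ℕ}
    (hi : i < m + 1) (n : ℕ) (a : ℕ → M) :
    ∑ j ∈ Finset.range (m + n + 1), a j
      = ∑ j ∈ Finset.range i, a j + ∑ k ∈ Finset.range (n + 1), a (i + k)
        + ∑ j ∈ Finset.Ico (i + 1) (m + 1), a (j + n) := by
  rw [Finset.sum_Ico_eq_sum_range, show m + n + 1 = i + (n + 1) + (m + 1 - (i + 1)) by omega,
    Finset.sum_range_add, Finset.sum_range_add]
  congr! 3 with j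
  ring

variable {K : Type*} [Field K] {V : Type*} [AddCommGroup V] [Module K V] {m n p : ℕ}

/-- The part of `(f ∘ g) ∘ h` in which `g` and `h` are inserted into different arguments of `f`,
with `h` to the left of `g`. -/
def disjointInsertions (f : Cochain K V V m) (g : Cochain K V V n) (h : Cochain K V V p)
    (s : ℕ → V) : V :=
  ∑ i ∈ Finset.range (m + 1), ∑ j ∈ Finset.range i, (-1 : ℤ) ^ (j * p + i * n) •
    partialComp j p (partialComp i n (evalSeq f) (evalSeq g)) (evalSeq h) s

theorem disjointInsertions_bilinearCochain (B : V →ₗ[K] V →ₗ[K] V) (g : Cochain K V V n)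
    (h : Cochain K V V p) (s : ℕ → V) :
    disjointInsertions (bilinearCochain B) g h s
      = (-1 : ℤ) ^ n • B (evalSeq h s) (evalSeq g fun k => s (1 + p + k)) := by
  rw [disjointInsertions, Finset.sum_range_succ, Finset.sum_range_one]
  simp [partialComp, evalSeq_bilinearCochain, insertSeq, add_right_comm 1 _ p]

theorem sum_partialComp_eq_nested_add_disjoint {i : ℕ} (hi : i < m + 1) (f : Cochain K V V m)
    (g : Cochain K V V n) (h : Cochain K V V p) (s : ℕ → V) :
    ∑ j ∈ Finset.range (m + n + 1), (-1 : ℤ) ^ (j * p + i * n) •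
        partialComp j p (partialComp i n (evalSeq f) (evalSeq g)) (evalSeq h) s
      = (-1 : ℤ) ^ (i * (n + p)) •
          partialComp i (n + p) (evalSeq f) (evalSeq (gerstenhaberComp n p g h)) s
        + ∑ j ∈ Finset.range i, (-1 : ℤ) ^ (j * p + i * n) •
            partialComp j p (partialComp i n (evalSeq f) (evalSeq g)) (evalSeq h) s
        + (-1 : ℤ) ^ (n * p) • ∑ j ∈ Finset.Ico (i + 1) (m + 1), (-1 : ℤ) ^ (i * n + j * p) •
            partialComp i n (partialComp j p (evalSeq f) (evalSeq h)) (evalSeq g) s := by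
  rw [sum_range_eq_left_add_middle_add_right hi, add_comm (∑ j ∈ Finset.range i, _)]
  congr 2
  · rw [partialComp, evalSeq_gerstenhaberComp, evalSeq_insertSeq_sum hi, Finset.smul_sum]
    refine Finset.sum_congr rfl fun k hk => ?_
    rw [partialComp_sequential (Finset.mem_range_succ_iff.1 hk), smul_smul, ← pow_add]
    congr 2
    ring
  · rw [Finset.smul_sum]
    refine Finset.sum_congr rfl fun j hj => ?_
    rw [← partialComp_parallel (Finset.mem_Ico.1 hj).1 _ _ _ (dependsOn_evalSeq g), smul_smul,
      ← pow_add]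
    congr 2
    ring

theorem evalSeq_gerstenhaberComp_assoc (f : Cochain K V V m) (g : Cochain K V V n)
    (h : Cochain K V V p) (s : ℕ → V) :
    evalSeq (gerstenhaberComp (m + n) p (gerstenhaberComp m n f g) h) s
      = evalSeq (gerstenhaberComp m (n + p) f (gerstenhaberComp n p g h)) s
        + disjointInsertions f g h s + (-1 : ℤ) ^ (n * p) • disjointInsertions f h g s := by
  have expand : evalSeq (gerstenhaberComp (m + n) p (gerstenhaberComp m n f g) h) s
      = ∑ i ∈ Finset.range (m + 1), ∑ j ∈ Finset.range (m + n + 1), (-1 : ℤ) ^ (j * p + i * n) •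
          partialComp j p (partialComp i n (evalSeq f) (evalSeq g)) (evalSeq h) s := by
    rw [Finset.sum_comm, evalSeq_gerstenhaberComp]
    refine Finset.sum_congr rfl fun j _ => ?_
    rw [partialComp, evalSeq_gerstenhaberComp, Finset.smul_sum]
    simp only [smul_smul, pow_add]
    rfl
  have swap : disjointInsertions f h g s
      = ∑ i ∈ Finset.range (m + 1), ∑ j ∈ Finset.Ico (i + 1) (m + 1),
          (-1 : ℤ) ^ (i * n + j * p) •
            partialComp i n (partialComp j p (evalSeq f) (evalSeq h)) (evalSeq g) s := by
    simp only [disjointInsertions, Finset.range_eq_Ico, Finset.sum_Ico_Ico_comm']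
  rw [expand, Finset.sum_congr rfl fun i hi =>
      sum_partialComp_eq_nested_add_disjoint (Finset.mem_range.1 hi) f g h s,
    Finset.sum_add_distrib, Finset.sum_add_distrib, ← Finset.smul_sum, ← swap,
    ← evalSeq_gerstenhaberComp]
  rfl

end Associator

section Grading

variable {K : Type*} [Field K] {V : Type*} [AddCommGroup V] [Module K V]
  {W : Type*} [AddCommGroup W] [Module K W]

theorem lof_mem_cochainGrading {n : ℕ} {d : ℤ} (h : (n : ℤ) = d) (f : Cochain K V W n) :
    DirectSum.lof K ℕ (Cochain K V W) n f ∈ cochainGrading K V W d := by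
  intro k hk
  rw [DirectSum.lof_eq_of, DirectSum.of_eq_of_ne]
  rintro rfl
  exact hk h

theorem eq_zero_or_eq_lof_of_mem_cochainGrading {d : ℤ} {x : Cochains K V W}
    (hx : x ∈ cochainGrading K V W d) :
    x = 0 ∨ ∃ (n : ℕ) (f : Cochain K V W n),
      d = n ∧ x = DirectSum.lof K ℕ (Cochain K V W) n f := by
  rcases le_or_gt 0 d with hd | hd
  · lift d to ℕ using hd
    refine Or.inr ⟨d, x d, rfl, DFinsupp.ext fun k => ?_⟩
    rcases eq_or_ne k d with rfl | hk
    · exact (DirectSum.lof_apply K k (x k)).symm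
    · have hkd : (k : ℤ) ≠ d := by exact_mod_cast hk
      exact (hx k hkd).trans (lof_mem_cochainGrading rfl (x d) k hkd).symm
  · exact Or.inl (DFinsupp.ext fun k => hx k (by lia))

theorem exists_eq_lof_ofSubsingleton_of_mem_cochainGrading_zero {x : Cochains K V W}
    (hx : x ∈ cochainGrading K V W 0) :
    ∃ D : V →ₗ[K] W, x = DirectSum.lof K ℕ (Cochain K V W) 0
      (MultilinearMap.ofSubsingleton K V W (0 : Fin 1) D) := by
  rcases eq_zero_or_eq_lof_of_mem_cochainGrading hx with rfl | ⟨n, f, hn, rfl⟩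
  · exact ⟨0, (map_zero _).symm⟩
  · obtain rfl : n = 0 := by exact_mod_cast hn.symm
    obtain ⟨D, rfl⟩ := (MultilinearMap.ofSubsingleton K V W (0 : Fin 1)).surjective f
    exact ⟨D, rfl⟩

/-- The value of the `(N+1)`-ary component of a cochain at the first `N + 1` entries of a
sequence. Through it, identities in the direct sum are checked by evaluation. -/
def componentEval (N : ℕ) (s : ℕ → V) : Cochains K V W →ₗ[K] W where
  toFun x := evalSeq (x N) s
  map_add' x y := by rw [DirectSum.add_apply]; rfl
  map_smul' c x := by rw [DirectSum.smul_apply]; rfl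

theorem cochains_ext {x y : Cochains K V W}
    (h : ∀ N s, componentEval N s x = componentEval N s y) : x = y :=
  DFinsupp.ext fun N => evalSeq_injective (funext (h N))

theorem cochains_bilinear_ext {V' W' M : Type*} [AddCommGroup V'] [Module K V'] [AddCommGroup W']
    [Module K W'] [AddCommGroup M] [Module K M]
    {B B' : Cochains K V W →ₗ[K] Cochains K V' W' →ₗ[K] M}
    (h : ∀ (m n : ℕ) (f : Cochain K V W m) (g : Cochain K V' W' n),
      B (DirectSum.lof K ℕ (Cochain K V W) m f) (DirectSum.lof K ℕ (Cochain K V' W') n g)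
        = B' (DirectSum.lof K ℕ (Cochain K V W) m f)
          (DirectSum.lof K ℕ (Cochain K V' W') n g)) : B = B' :=
  DirectSum.linearMap_ext K fun m => LinearMap.ext fun f =>
    DirectSum.linearMap_ext K fun n => LinearMap.ext fun g => h m n f g

theorem componentEval_lof {n : ℕ} (f : Cochain K V W n) (N : ℕ) (s : ℕ → V) :
    componentEval N s (DirectSum.lof K ℕ (Cochain K V W) n f)
      = if n = N then evalSeq f s else 0 := by
  split_ifs with h
  · subst h
    exact congrArg (evalSeq · s) (DirectSum.lof_apply K n f)
  · exact congrArg (evalSeq · s) (lof_mem_cochainGrading rfl f N (by exact_mod_cast Ne.symm h))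

theorem isInternal_cochainGrading : DirectSum.IsInternal (cochainGrading K V W) :=
  letI : DirectSum.Decomposition (cochainGrading K V W) := .ofLinearMap _
    (DirectSum.toModule K ℕ _ fun n =>
      (DirectSum.lof K ℤ (fun d => cochainGrading K V W d) n).comp
        ((DirectSum.lof K ℕ (Cochain K V W) n).codRestrict _ fun f =>
          lof_mem_cochainGrading rfl f))
    (DirectSum.linearMap_ext K fun n => LinearMap.ext fun f => by simp)
    (DirectSum.linearMap_ext K fun d => LinearMap.ext fun ⟨x, hx⟩ => by
      rcases eq_zero_or_eq_lof_of_mem_cochainGrading hx with rfl | ⟨n, f, rfl, rfl⟩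
      · exact (map_zero _).trans (map_zero _).symm
      · simp only [LinearMap.comp_apply, DirectSum.coeLinearMap_lof, DirectSum.toModule_lof,
          LinearMap.id_apply]
        rfl)
  DirectSum.Decomposition.isInternal _

end Grading

/-- The Gerstenhaber composition, extended bilinearly to `⨁_{n ≥ 0} Hom(⊗^{n+1} V, V)`. Unlike the
bracket, it allows statements that avoid dividing by `2`. -/
def cochainsComp (K : Type*) [Field K] (V : Type*) [AddCommGroup V] [Module K V] :
    Cochains K V V →ₗ[K] Cochains K V V →ₗ[K] Cochains K V V :=
  DirectSum.toModule K ℕ _ fun m =>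
    LinearMap.flip <| DirectSum.toModule K ℕ _ fun n => LinearMap.flip <|
      (gerstenhaberComp m n).compr₂ (DirectSum.lof K ℕ (Cochain K V V) (m + n))

local notation:70 x:70 "⋆" y:71 => cochainsComp _ _ x y
local notation "⁅" x "," y "⁆_G" => gerstenhaberBracket _ _ x y

section Composition

theorem coe_negOnePow_eq_one_or_neg_one (i : ℤ) :
    (i.negOnePow : ℤ) = 1 ∨ (i.negOnePow : ℤ) = -1 := by
  rcases Int.units_eq_one_or i.negOnePow with h | h <;> simp [h]

variable {K : Type*} [Field K] {V : Type*} [AddCommGroup V] [Module K V]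

theorem cochainsComp_lof {m n : ℕ} (f : Cochain K V V m) (g : Cochain K V V n) :
    DirectSum.lof K ℕ (Cochain K V V) m f ⋆ DirectSum.lof K ℕ (Cochain K V V) n g
      = DirectSum.lof K ℕ (Cochain K V V) (m + n) (gerstenhaberComp m n f g) := by
  simp [cochainsComp]

theorem componentEval_cochainsComp_assoc {m n p : ℕ} (f : Cochain K V V m) (g : Cochain K V V n)
    (h : Cochain K V V p) (N : ℕ) (s : ℕ → V) :
    componentEval N s (DirectSum.lof K ℕ (Cochain K V V) m f ⋆
        DirectSum.lof K ℕ (Cochain K V V) n g ⋆ DirectSum.lof K ℕ (Cochain K V V) p h)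
      = componentEval N s (DirectSum.lof K ℕ (Cochain K V V) m f ⋆
          (DirectSum.lof K ℕ (Cochain K V V) n g ⋆ DirectSum.lof K ℕ (Cochain K V V) p h))
        + if m + n + p = N then disjointInsertions f g h s
            + (-1 : ℤ) ^ (n * p) • disjointInsertions f h g s else 0 := by
  simp only [cochainsComp_lof, componentEval_lof, evalSeq_gerstenhaberComp_assoc,
    add_assoc]
  split_ifs <;> simp

variable {i j k : ℤ} {x y z : Cochains K V V}

theorem cochainsComp_mem (hx : x ∈ cochainGrading K V V i) (hy : y ∈ cochainGrading K V V j) :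
    x ⋆ y ∈ cochainGrading K V V (i + j) := by
  rcases eq_zero_or_eq_lof_of_mem_cochainGrading hx with rfl | ⟨m, f, rfl, rfl⟩
  · simp
  rcases eq_zero_or_eq_lof_of_mem_cochainGrading hy with rfl | ⟨n, g, rfl, rfl⟩
  · simp
  rw [cochainsComp_lof]
  exact lof_mem_cochainGrading (Nat.cast_add m n) _

theorem gerstenhaberBracket_eq (hx : x ∈ cochainGrading K V V i)
    (hy : y ∈ cochainGrading K V V j) :
    ⁅x, y⁆_G = x ⋆ y - ((i * j).negOnePow : ℤ) • (y ⋆ x) := by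
  rcases eq_zero_or_eq_lof_of_mem_cochainGrading hx with rfl | ⟨m, f, rfl, rfl⟩
  · simp
  rcases eq_zero_or_eq_lof_of_mem_cochainGrading hy with rfl | ⟨n, g, rfl, rfl⟩
  · simp
  rw [cochainsComp_lof, cochainsComp_lof, ← Nat.cast_mul, Int.coe_negOnePow_natCast]
  simp [gerstenhaberBracket]

theorem gerstenhaberBracket_mem (hx : x ∈ cochainGrading K V V i)
    (hy : y ∈ cochainGrading K V V j) : ⁅x, y⁆_G ∈ cochainGrading K V V (i + j) := by
  rw [gerstenhaberBracket_eq hx hy]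
  exact sub_mem (cochainsComp_mem hx hy) (zsmul_mem (add_comm j i ▸ cochainsComp_mem hy hx) _)

theorem gerstenhaberBracket_antisymm (hx : x ∈ cochainGrading K V V i)
    (hy : y ∈ cochainGrading K V V j) :
    ⁅x, y⁆_G = -((i * j).negOnePow : ℤ) • ⁅y, x⁆_G := by
  rw [gerstenhaberBracket_eq hx hy, gerstenhaberBracket_eq hy hx, mul_comm j i]
  rcases coe_negOnePow_eq_one_or_neg_one (i * j) with h | h <;> rw [h] <;> module

theorem cochainsComp_preLie (hx : x ∈ cochainGrading K V V i) (hy : y ∈ cochainGrading K V V j)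
    (hz : z ∈ cochainGrading K V V k) :
    x ⋆ y ⋆ z - x ⋆ (y ⋆ z)
      = ((j * k).negOnePow : ℤ) • (x ⋆ z ⋆ y - x ⋆ (z ⋆ y)) := by
  rcases eq_zero_or_eq_lof_of_mem_cochainGrading hx with rfl | ⟨m, f, rfl, rfl⟩
  · simp
  rcases eq_zero_or_eq_lof_of_mem_cochainGrading hy with rfl | ⟨n, g, rfl, rfl⟩
  · simp
  rcases eq_zero_or_eq_lof_of_mem_cochainGrading hz with rfl | ⟨p, h, rfl, rfl⟩
  · simp
  refine cochains_ext fun N s => ?_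
  simp only [map_sub, map_zsmul, componentEval_cochainsComp_assoc, add_sub_cancel_left,
    ← Nat.cast_mul, Int.coe_negOnePow_natCast, mul_comm p n, add_right_comm m p n]
  split_ifs
  · rcases neg_one_pow_eq_or ℤ (n * p) with e | e <;> rw [e] <;> module
  · rw [smul_zero]

/-- In characteristic `2` this does not follow from `cochainsComp_preLie`. -/
theorem cochainsComp_cochainsComp_self_of_odd (hx : x ∈ cochainGrading K V V i)
    (hy : y ∈ cochainGrading K V V j) (hj : Odd j) : x ⋆ y ⋆ y = x ⋆ (y ⋆ y) := by
  rcases eq_zero_or_eq_lof_of_mem_cochainGrading hx with rfl | ⟨m, f, rfl, rfl⟩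
  · simp
  rcases eq_zero_or_eq_lof_of_mem_cochainGrading hy with rfl | ⟨n, g, rfl, rfl⟩
  · simp
  refine cochains_ext fun N s => ?_
  have hn : Odd n := by exact_mod_cast hj
  rw [componentEval_cochainsComp_assoc, (hn.mul hn).neg_one_pow, neg_one_smul, add_neg_cancel,
    ite_self, add_zero]

theorem gerstenhaberBracket_jacobi (hx : x ∈ cochainGrading K V V i)
    (hy : y ∈ cochainGrading K V V j) (hz : z ∈ cochainGrading K V V k) :
    ⁅x, ⁅y, z⁆_G⁆_G
      = ⁅⁅x, y⁆_G, z⁆_G - ((j * k).negOnePow : ℤ) • ⁅⁅x, z⁆_G, y⁆_G := by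
  have hxyz := cochainsComp_preLie hx hy hz
  have hyxz := cochainsComp_preLie hy hx hz
  have hzxy := cochainsComp_preLie hz hx hy
  rw [gerstenhaberBracket_eq hx (gerstenhaberBracket_mem hy hz),
    gerstenhaberBracket_eq (gerstenhaberBracket_mem hx hy) hz,
    gerstenhaberBracket_eq (gerstenhaberBracket_mem hx hz) hy,
    gerstenhaberBracket_eq hx hy, gerstenhaberBracket_eq hy hz, gerstenhaberBracket_eq hx hz]
  simp only [map_sub, map_zsmul, LinearMap.sub_apply, LinearMap.smul_apply, mul_add, add_mul,
    Int.negOnePow_add, Units.val_mul, mul_comm k j] at hxyz hyxz hzxy ⊢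
  linear_combination (norm := skip)
    (-1 : ℤ) • hxyz + ((i * j).negOnePow : ℤ) • hyxz
      - (((i * k).negOnePow : ℤ) * ((j * k).negOnePow : ℤ)) • hzxy
  rcases coe_negOnePow_eq_one_or_neg_one (i * j) with hij | hij <;>
    rcases coe_negOnePow_eq_one_or_neg_one (i * k) with hik | hik <;>
    rcases coe_negOnePow_eq_one_or_neg_one (j * k) with hjk | hjk <;>
    rw [hij, hik, hjk] <;> module

theorem gerstenhaberBracket_bracket_self_of_sq_eq_zero (hx : x ∈ cochainGrading K V V i)
    (hi : Odd i) (hy : y ∈ cochainGrading K V V j) (hxx : cochainsComp K V x x = 0) :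
    ⁅x, ⁅x, y⁆_G⁆_G = 0 := by
  have hxxy := cochainsComp_preLie hx hx hy
  have hyxx := cochainsComp_cochainsComp_self_of_odd hy hx hi
  rw [hxx, map_zero] at hyxx
  rw [hxx, map_zero, LinearMap.zero_apply] at hxxy
  rw [gerstenhaberBracket_eq hx (gerstenhaberBracket_mem hx hy), gerstenhaberBracket_eq hx hy]
  simp only [map_sub, map_zsmul, LinearMap.sub_apply, LinearMap.smul_apply, mul_add,
    Int.negOnePow_add, Units.val_mul, hyxx, Int.negOnePow_odd _ (hi.mul hi), Units.val_neg,
    Units.val_one]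
  linear_combination (norm := skip) (-1 : ℤ) • hxxy
  rcases coe_negOnePow_eq_one_or_neg_one (i * j) with h | h <;> rw [h] <;> module

end Composition

section QuadraticCurvedLInfty

theorem koszulSign_one {n : ℕ} (d : Fin n → ℤ) : koszulSign d 1 = 1 :=
  Finset.prod_eq_one fun _ hp => absurd (Finset.mem_filter.1 hp).2 fun h => lt_asymm h.1 h.2

theorem koszulSign_eq_prod_of_inversions_eq {n : ℕ} (d : Fin n → ℤ) {σ : Equiv.Perm (Fin n)}
    {S : Finset (Fin n × Fin n)}
    (hS : Finset.univ.filter (fun p : Fin n × Fin n => p.1 < p.2 ∧ σ p.2 < σ p.1) = S) :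
    koszulSign d σ = ∏ p ∈ S, ((d (σ p.1) * d (σ p.2)).negOnePow : ℤ) := by
  rw [koszulSign, hS]

theorem koszulSign_swap_zero_one (d : Fin 2 → ℤ) :
    koszulSign d (Equiv.swap 0 1) = ((d 0 * d 1).negOnePow : ℤ) := by
  rw [koszulSign_eq_prod_of_inversions_eq d (S := {(0, 1)}) (by decide), Finset.prod_singleton,
    Equiv.swap_apply_left, Equiv.swap_apply_right, mul_comm]

theorem koszulSign_swap_one_two (d : Fin 3 → ℤ) :
    koszulSign d (Equiv.swap 1 2) = ((d 1 * d 2).negOnePow : ℤ) := by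
  rw [koszulSign_eq_prod_of_inversions_eq d (S := {(1, 2)}) (by decide), Finset.prod_singleton,
    Equiv.swap_apply_left, Equiv.swap_apply_right, mul_comm]

theorem koszulSign_finRotate_three (d : Fin 3 → ℤ) :
    koszulSign d (finRotate 3) = ((d 0 * (d 1 + d 2)).negOnePow : ℤ) := by
  rw [koszulSign_eq_prod_of_inversions_eq d (S := {(0, 2), (1, 2)}) (by decide),
    Finset.prod_pair (by decide), mul_add, Int.negOnePow_add, Units.val_mul, mul_comm (d 0),
    mul_comm (d 0)]
  rfl

variable {K : Type*} [Field K] {g : Type*} [AddCommGroup g] [Module K g]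

/-- The operations `l_0 = c`, `l_1 = δ`, `l_2 = b` and `l_k = 0` for `k ≥ 3`. -/
def quadraticOps (c : g) (δ : g →ₗ[K] g) (b : g →ₗ[K] g →ₗ[K] g) :
    ∀ k : ℕ, MultilinearMap K (fun _ : Fin k => g) g
  | 0 => MultilinearMap.constOfIsEmpty K _ c
  | 1 => MultilinearMap.ofSubsingleton K g g 0 δ
  | 2 => bilinearCochain b
  | _ + 3 => 0

/-- A curved differential graded Lie algebra with curvature `c`, differential `δ` and bracket `b`,
in the degree-shifted convention: `b` has degree `1` and is graded symmetric. -/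
structure IsShiftedCurvedDGLie (𝒢 : ℤ → Submodule K g) (c : g) (δ : g →ₗ[K] g)
    (b : g →ₗ[K] g →ₗ[K] g) : Prop where
  graded : DirectSum.IsInternal 𝒢
  curvature_mem : c ∈ 𝒢 1
  differential_mem : ∀ {i x}, x ∈ 𝒢 i → δ x ∈ 𝒢 (i + 1)
  bracket_mem : ∀ {i j x y}, x ∈ 𝒢 i → y ∈ 𝒢 j → b x y ∈ 𝒢 (i + j + 1)
  bracket_symm : ∀ {i j x y}, x ∈ 𝒢 i → y ∈ 𝒢 j → b y x = ((i * j).negOnePow : ℤ) • b x y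
  bianchi : δ c = 0
  differential_sq : ∀ {i x}, x ∈ 𝒢 i → b c x + δ (δ x) = 0
  leibniz : ∀ {i j x y}, x ∈ 𝒢 i → y ∈ 𝒢 j →
    δ (b x y) + b (δ x) y + ((i * j).negOnePow : ℤ) • b (δ y) x = 0
  jacobi : ∀ {i j k x y z}, x ∈ 𝒢 i → y ∈ 𝒢 j → z ∈ 𝒢 k →
    b (b x y) z + ((j * k).negOnePow : ℤ) • b (b x z) y
      + ((i * (j + k)).negOnePow : ℤ) • b (b y z) x = 0

/-- The terms of the generalized Jacobi identity in which the inner operation has arity `i`. -/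
def jacobiTerm (l : ∀ k : ℕ, MultilinearMap K (fun _ : Fin k => g) g) {n : ℕ} (d : Fin n → ℤ)
    (x : Fin n → g) (i : Fin (n + 1)) : g :=
  ∑ σ ∈ shuffles n i, koszulSign d σ •
    l (n - i + 1) (Fin.cons (α := fun _ => g) (l i (fun a : Fin i => x (σ ⟨a, by omega⟩)))
      (fun b : Fin (n - i) => x (σ ⟨i + b, by omega⟩)))

variable {𝒢 : ℤ → Submodule K g} {c : g} {δ : g →ₗ[K] g} {b : g →ₗ[K] g →ₗ[K] g}

theorem jacobiTerm_quadraticOps_eq_zero {n : ℕ} (d : Fin n → ℤ) (x : Fin n → g) {i : Fin (n + 1)}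
    (h : 3 ≤ (i : ℕ) ∨ 2 ≤ n - i) : jacobiTerm (quadraticOps c δ b) d x i = 0 := by
  have eq_zero {k : ℕ} (hk : 3 ≤ k) : quadraticOps c δ b k = 0 := by
    obtain ⟨k, rfl⟩ := Nat.exists_eq_add_of_le' hk
    rfl
  refine Finset.sum_eq_zero fun σ _ => ?_
  rcases h with h | h
  · rw [eq_zero h, MultilinearMap.map_coord_zero _ 0 rfl, smul_zero]
  · rw [eq_zero (by omega), zero_apply, smul_zero]

theorem jacobiTerm_quadraticOps_zero_zero (d : Fin 0 → ℤ) (x : Fin 0 → g) :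
    jacobiTerm (quadraticOps c δ b) d x 0 = δ c := by
  rw [jacobiTerm, show shuffles 0 (0 : Fin 1) = {1} by decide, Finset.sum_singleton,
    koszulSign_one, one_smul]
  rfl

theorem jacobiTerm_quadraticOps_one_zero (d : Fin 1 → ℤ) (x : Fin 1 → g) :
    jacobiTerm (quadraticOps c δ b) d x 0 = b c (x 0) := by
  rw [jacobiTerm, show shuffles 1 (0 : Fin 2) = {1} by decide, Finset.sum_singleton,
    koszulSign_one, one_smul]
  rfl

theorem jacobiTerm_quadraticOps_one_one (d : Fin 1 → ℤ) (x : Fin 1 → g) :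
    jacobiTerm (quadraticOps c δ b) d x 1 = δ (δ (x 0)) := by
  rw [jacobiTerm, show shuffles 1 (1 : Fin 2) = {1} by decide, Finset.sum_singleton,
    koszulSign_one, one_smul]
  rfl

theorem jacobiTerm_quadraticOps_two_one (d : Fin 2 → ℤ) (x : Fin 2 → g) :
    jacobiTerm (quadraticOps c δ b) d x 1
      = b (δ (x 0)) (x 1) + ((d 0 * d 1).negOnePow : ℤ) • b (δ (x 1)) (x 0) := by
  rw [jacobiTerm, show shuffles 2 (1 : Fin 3) = {1, Equiv.swap 0 1} by decide,
    Finset.sum_pair (by decide), koszulSign_one, one_smul, koszulSign_swap_zero_one]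
  rfl

theorem jacobiTerm_quadraticOps_two_two (d : Fin 2 → ℤ) (x : Fin 2 → g) :
    jacobiTerm (quadraticOps c δ b) d x 2 = δ (b (x 0) (x 1)) := by
  rw [jacobiTerm, show shuffles 2 (2 : Fin 3) = {1} by decide, Finset.sum_singleton,
    koszulSign_one, one_smul]
  rfl

theorem jacobiTerm_quadraticOps_three_two (d : Fin 3 → ℤ) (x : Fin 3 → g) :
    jacobiTerm (quadraticOps c δ b) d x 2
      = b (b (x 0) (x 1)) (x 2) + ((d 1 * d 2).negOnePow : ℤ) • b (b (x 0) (x 2)) (x 1)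
        + ((d 0 * (d 1 + d 2)).negOnePow : ℤ) • b (b (x 1) (x 2)) (x 0) := by
  rw [jacobiTerm, show shuffles 3 (2 : Fin 4) = {1, Equiv.swap 1 2, finRotate 3} by decide,
    Finset.sum_insert (by decide), Finset.sum_pair (by decide), koszulSign_one, one_smul,
    koszulSign_swap_one_two, koszulSign_finRotate_three, ← add_assoc]
  rfl

namespace IsShiftedCurvedDGLie

theorem sum_jacobiTerm_eq_zero (h : IsShiftedCurvedDGLie 𝒢 c δ b) {n : ℕ} {d : Fin n → ℤ}
    {x : Fin n → g} (hx : ∀ a, x a ∈ 𝒢 (d a)) :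
    ∑ i, jacobiTerm (quadraticOps c δ b) d x i = 0 := by
  match n with
  | 0 => rw [Fin.sum_univ_one, jacobiTerm_quadraticOps_zero_zero, h.bianchi]
  | 1 =>
    rw [Fin.sum_univ_two, jacobiTerm_quadraticOps_one_zero, jacobiTerm_quadraticOps_one_one,
      h.differential_sq (hx 0)]
  | 2 =>
    rw [Fin.sum_univ_three, jacobiTerm_quadraticOps_eq_zero d x (Or.inr le_rfl), zero_add,
      jacobiTerm_quadraticOps_two_one, jacobiTerm_quadraticOps_two_two, add_comm, ← add_assoc,
      h.leibniz (hx 0) (hx 1)]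
  | 3 =>
    rw [Fin.sum_univ_four, jacobiTerm_quadraticOps_three_two,
      jacobiTerm_quadraticOps_eq_zero d x (Or.inr (by decide)),
      jacobiTerm_quadraticOps_eq_zero d x (Or.inr (by decide)),
      jacobiTerm_quadraticOps_eq_zero d x (Or.inl le_rfl), zero_add, zero_add, add_zero,
      h.jacobi (hx 0) (hx 1) (hx 2)]
  | n + 4 =>
    exact Finset.sum_eq_zero fun i _ => jacobiTerm_quadraticOps_eq_zero d x (by omega)

theorem quadraticOps_mem (h : IsShiftedCurvedDGLie 𝒢 c δ b) {n : ℕ} {d : Fin n → ℤ}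
    {x : Fin n → g} (hx : ∀ a, x a ∈ 𝒢 (d a)) :
    quadraticOps c δ b n x ∈ 𝒢 (∑ a, d a + 1) := by
  match n with
  | 0 =>
    rw [Fin.sum_univ_zero, zero_add]
    exact h.curvature_mem
  | 1 =>
    rw [Fin.sum_univ_one]
    exact h.differential_mem (hx 0)
  | 2 =>
    rw [Fin.sum_univ_two]
    exact h.bracket_mem (hx 0) (hx 1)
  | n + 3 => exact zero_mem _

theorem quadraticOps_symm (h : IsShiftedCurvedDGLie 𝒢 c δ b) {n : ℕ} {d : Fin n → ℤ}
    {x : Fin n → g} (hx : ∀ a, x a ∈ 𝒢 (d a)) (σ : Equiv.Perm (Fin n)) :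
    quadraticOps c δ b n (fun a => x (σ a)) = koszulSign d σ • quadraticOps c δ b n x := by
  rcases eq_or_ne σ 1 with rfl | hσ
  · rw [koszulSign_one, one_smul]
    rfl
  match n with
  | 0 | 1 => exact absurd (Subsingleton.elim σ 1) hσ
  | 2 =>
    obtain rfl : σ = Equiv.swap 0 1 := by decide +revert
    rw [koszulSign_swap_zero_one]
    exact h.bracket_symm (hx 0) (hx 1)
  | n + 3 => exact (smul_zero _).symm

theorem isCurvedLInfty_quadraticOps (h : IsShiftedCurvedDGLie 𝒢 c δ b) :
    IsCurvedLInfty 𝒢 (quadraticOps c δ b) where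
  graded := h.graded
  degree_one _ _ _ := h.quadraticOps_mem
  symm _ _ _ := h.quadraticOps_symm
  jacobi _ _ _ := h.sum_jacobiTerm_eq_zero

end IsShiftedCurvedDGLie

theorem isMaurerCartan_quadraticOps_iff {x : g} :
    IsMaurerCartan 𝒢 (quadraticOps c δ b) x ↔
      x ∈ 𝒢 0 ∧ c + (δ x + (2 : K)⁻¹ • b x x) = 0 := by
  have support_subset : (Function.support fun k : ℕ => (((k + 1).factorial : K)⁻¹) •
      quadraticOps c δ b (k + 1) (fun _ => x)) ⊆ ({0, 1} : Finset ℕ) := by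
    intro k hk
    match k with
    | 0 | 1 => simp
    | k + 2 => exact absurd (smul_zero _) hk
  rw [IsMaurerCartan, and_iff_right ((Finset.finite_toSet _).subset support_subset),
    finsum_eq_sum_of_support_subset _ support_subset, Finset.sum_pair zero_ne_one]
  have one_smul_inv : (((0 + 1).factorial : K)⁻¹) • δ x = δ x := by simp
  have two_factorial : ((1 + 1).factorial : K) = 2 := by simp
  rw [two_factorial]
  exact Iff.rfl.and (by rw [← one_smul_inv]; rfl)

end QuadraticCurvedLInfty

section Lift

variable {K : Type*} [Field K] {A A' : Type*} [AddCommGroup A] [Module K A]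
  [AddCommGroup A'] [Module K A'] {m n : ℕ}

/-- The lift `((x_1, u_1), …) ↦ (0, f(x_1, …))` of a cochain. -/
def liftCochain (f : Cochain K A A' n) : Cochain K (A × A') (A × A') n :=
  (LinearMap.inr K A A').compMultilinearMap (f.compLinearMap fun _ => LinearMap.fst K A A')

theorem evalSeq_liftCochain (f : Cochain K A A' n) (s : ℕ → A × A') :
    evalSeq (liftCochain f) s = (0, evalSeq f fun k => (s k).1) := rfl

/-- The projection `(x_1, …) ↦ pr_2 (h((x_1, 0), …))` of a cochain. -/
def projCochain (h : Cochain K (A × A') (A × A') n) : Cochain K A A' n :=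
  (LinearMap.snd K A A').compMultilinearMap (h.compLinearMap fun _ => LinearMap.inl K A A')

theorem evalSeq_projCochain (h : Cochain K (A × A') (A × A') n) (s : ℕ → A) :
    evalSeq (projCochain h) s = (evalSeq h fun k => (s k, 0)).2 := rfl

theorem cochainLift_lof (f : Cochain K A A' n) :
    cochainLift K A A' (DirectSum.lof K ℕ (Cochain K A A') n f)
      = DirectSum.lof K ℕ (Cochain K (A × A') (A × A')) n (liftCochain f) := by
  rw [cochainLift, DirectSum.lmap_lof]
  rfl

theorem cochainProj_lof (h : Cochain K (A × A') (A × A') n) :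
    cochainProj K A A' (DirectSum.lof K ℕ (Cochain K (A × A') (A × A')) n h)
      = DirectSum.lof K ℕ (Cochain K A A') n (projCochain h) := by
  rw [cochainProj, DirectSum.lmap_lof]
  rfl

theorem componentEval_cochainLift (x : Cochains K A A') (N : ℕ) (s : ℕ → A × A') :
    componentEval N s (cochainLift K A A' x) = (0, componentEval N (fun k => (s k).1) x) := by
  change evalSeq (cochainLift K A A' x N) s = _
  rw [cochainLift, DirectSum.lmap_apply]
  rfl

theorem componentEval_cochainProj (x : Cochains K (A × A') (A × A')) (N : ℕ) (s : ℕ → A) :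
    componentEval N s (cochainProj K A A' x) = (componentEval N (fun k => (s k, 0)) x).2 := by
  change evalSeq (cochainProj K A A' x N) s = _
  rw [cochainProj, DirectSum.lmap_apply]
  rfl

theorem fst_insertSeq {X Y : Type*} (i n : ℕ) (v : X × Y) (s : ℕ → X × Y) :
    (fun k => (insertSeq i n v s k).1) = insertSeq i n v.1 fun k => (s k).1 := by
  funext k
  simp only [insertSeq]
  split_ifs <;> rfl

theorem evalSeq_liftCochain_gerstenhaberComp (f : Cochain K A A' m)
    (g : Cochain K (A × A') (A × A') n) (s : ℕ → A × A') :
    evalSeq (gerstenhaberComp m n (liftCochain f) g) s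
      = (0, ∑ i ∈ Finset.range (m + 1), (-1 : ℤ) ^ (i * n) •
          evalSeq f (insertSeq i n (evalSeq g fun k => s (i + k)).1 fun k => (s k).1)) := by
  rw [evalSeq_gerstenhaberComp]
  ext <;> simp [partialComp, evalSeq_liftCochain, fst_insertSeq, Prod.fst_sum, Prod.snd_sum]

theorem liftCochain_gerstenhaberComp_eq_zero (f : Cochain K A A' m)
    {g : Cochain K (A × A') (A × A') n} (hg : ∀ s, (evalSeq g s).1 = 0) :
    gerstenhaberComp m n (liftCochain f) g = 0 := by
  refine evalSeq_injective (funext fun s => ?_)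
  rw [evalSeq_liftCochain_gerstenhaberComp, Finset.sum_eq_zero]
  · rfl
  · intro i hi
    rw [hg, evalSeq_insertSeq_zero (Finset.mem_range.1 hi), smul_zero]

variable {i j k : ℤ} {x y : Cochains K A A'}

theorem cochainLift_mem (hx : x ∈ cochainGrading K A A' i) :
    cochainLift K A A' x ∈ cochainGrading K (A × A') (A × A') i := by
  rcases eq_zero_or_eq_lof_of_mem_cochainGrading hx with rfl | ⟨m, f, rfl, rfl⟩
  · simp
  · exact cochainLift_lof f ▸ lof_mem_cochainGrading rfl _

theorem cochainProj_mem {h : Cochains K (A × A') (A × A')}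
    (hh : h ∈ cochainGrading K (A × A') (A × A') i) :
    cochainProj K A A' h ∈ cochainGrading K A A' i := by
  rcases eq_zero_or_eq_lof_of_mem_cochainGrading hh with rfl | ⟨m, f, rfl, rfl⟩
  · simp
  · exact cochainProj_lof f ▸ lof_mem_cochainGrading rfl _

theorem cochainLift_cochainsComp_cochainLift (hx : x ∈ cochainGrading K A A' i)
    (hy : y ∈ cochainGrading K A A' j) : cochainLift K A A' x ⋆ cochainLift K A A' y = 0 := by
  rcases eq_zero_or_eq_lof_of_mem_cochainGrading hx with rfl | ⟨m, f, rfl, rfl⟩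
  · simp
  rcases eq_zero_or_eq_lof_of_mem_cochainGrading hy with rfl | ⟨n, g, rfl, rfl⟩
  · simp
  rw [cochainLift_lof, cochainLift_lof, cochainsComp_lof,
    liftCochain_gerstenhaberComp_eq_zero _ fun s => congrArg Prod.fst (evalSeq_liftCochain g s),
    map_zero]

theorem cochainLift_cochainsComp_cochainLift_cochainsComp {h : Cochains K (A × A') (A × A')}
    (hx : x ∈ cochainGrading K A A' i) (hy : y ∈ cochainGrading K A A' j)
    (hh : h ∈ cochainGrading K (A × A') (A × A') k) :
    cochainLift K A A' x ⋆ (cochainLift K A A' y ⋆ h) = 0 := by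
  rcases eq_zero_or_eq_lof_of_mem_cochainGrading hx with rfl | ⟨m, f, rfl, rfl⟩
  · simp
  rcases eq_zero_or_eq_lof_of_mem_cochainGrading hy with rfl | ⟨n, g, rfl, rfl⟩
  · simp
  rcases eq_zero_or_eq_lof_of_mem_cochainGrading hh with rfl | ⟨p, h, rfl, rfl⟩
  · simp
  rw [cochainLift_lof, cochainLift_lof, cochainsComp_lof, cochainsComp_lof,
    liftCochain_gerstenhaberComp_eq_zero _ fun s =>
      congrArg Prod.fst (evalSeq_liftCochain_gerstenhaberComp g h s), map_zero]

theorem gerstenhaberBracket_cochainLift_cochainLift (x y : Cochains K A A') :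
    ⁅cochainLift K A A' x, cochainLift K A A' y⁆_G = 0 := by
  have bilinear_eq : (gerstenhaberBracket K (A × A')).compl₁₂ (cochainLift K A A')
      (cochainLift K A A') = 0 := by
    refine cochains_bilinear_ext fun m n f g => ?_
    have hf := lof_mem_cochainGrading rfl f
    have hg := lof_mem_cochainGrading rfl g
    rw [LinearMap.compl₁₂_apply, gerstenhaberBracket_eq (cochainLift_mem hf) (cochainLift_mem hg),
      cochainLift_cochainsComp_cochainLift hf hg, cochainLift_cochainsComp_cochainLift hg hf,
      smul_zero, sub_zero]
    rfl
  exact LinearMap.congr_fun₂ bilinear_eq x y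

/-- An inner value `(a, b)` splits as `(0, b) + (a, 0)`: the first summand only sees the projection
of the inner cochain, the second only that of the outer one. -/
theorem snd_partialComp_eq_add {l : ℕ} (hl : l < m + 1) (f : Cochain K (A × A') (A × A') m)
    (g : Cochain K (A × A') (A × A') n) (s : ℕ → A) :
    (partialComp l n (evalSeq f) (evalSeq g) fun k => (s k, 0)).2
      = (partialComp l n (evalSeq f) (evalSeq (liftCochain (projCochain g)))
          fun k => (s k, 0)).2
        + (partialComp l n (evalSeq (liftCochain (projCochain f))) (evalSeq g)
          fun k => (s k, 0)).2 := by
  set v := evalSeq g fun k => (s (l + k), 0) with hv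
  have insert_fst : insertSeq l n ((v.1, 0) : A × A') (fun k => (s k, 0))
      = fun k => (insertSeq l n v.1 s k, 0) := by
    funext k
    simp only [insertSeq]
    split_ifs <;> rfl
  have split : v = (0, v.2) + (v.1, 0) := by simp
  simp only [partialComp, evalSeq_liftCochain, evalSeq_projCochain, fst_insertSeq, ← hv]
  rw [split, evalSeq_insertSeq_add hl, Prod.snd_add, insert_fst]
  simp

theorem cochainProj_cochainsComp {x y : Cochains K (A × A') (A × A')}
    (hx : x ∈ cochainGrading K (A × A') (A × A') i)
    (hy : y ∈ cochainGrading K (A × A') (A × A') j) :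
    cochainProj K A A' (x ⋆ y)
      = cochainProj K A A' (x ⋆ cochainLift K A A' (cochainProj K A A' y))
        + cochainProj K A A' (cochainLift K A A' (cochainProj K A A' x) ⋆ y) := by
  rcases eq_zero_or_eq_lof_of_mem_cochainGrading hx with rfl | ⟨m, f, rfl, rfl⟩
  · simp
  rcases eq_zero_or_eq_lof_of_mem_cochainGrading hy with rfl | ⟨n, g, rfl, rfl⟩
  · simp
  simp only [cochainProj_lof, cochainLift_lof, cochainsComp_lof]
  rw [← map_add]
  refine congrArg _ (evalSeq_injective (funext fun s => ?_))
  simp only [evalSeq_add, evalSeq_projCochain, evalSeq_gerstenhaberComp, Prod.snd_sum,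
    Prod.smul_snd]
  rw [← Finset.sum_add_distrib]
  refine Finset.sum_congr rfl fun l hl => ?_
  rw [snd_partialComp_eq_add (Finset.mem_range.1 hl), smul_add]

theorem cochainProj_gerstenhaberBracket {x y : Cochains K (A × A') (A × A')}
    (hx : x ∈ cochainGrading K (A × A') (A × A') i)
    (hy : y ∈ cochainGrading K (A × A') (A × A') j) :
    cochainProj K A A' ⁅x, y⁆_G
      = cochainProj K A A' ⁅cochainLift K A A' (cochainProj K A A' x), y⁆_G
        + cochainProj K A A' ⁅x, cochainLift K A A' (cochainProj K A A' y)⁆_G := by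
  rw [gerstenhaberBracket_eq hx hy,
    gerstenhaberBracket_eq (cochainLift_mem (cochainProj_mem hx)) hy,
    gerstenhaberBracket_eq hx (cochainLift_mem (cochainProj_mem hy)), map_sub, map_zsmul,
    cochainProj_cochainsComp hx hy, cochainProj_cochainsComp hy hx]
  simp only [map_sub, map_zsmul]
  module

end Lift

namespace QuasiTwilledAlgebra

variable {K : Type*} [Field K] {A A' : Type*} [AddCommGroup A] [Module K A]
  [AddCommGroup A'] [Module K A'] (Q : QuasiTwilledAlgebra K A A')

section ExplicitFormula

/-- The left action `u · a` of the subalgebra `A'` on `A`, the `A`-component of the product. -/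
def leftAct (u : A') (a : A) : A := (Q.mul (0, u) (a, 0)).1

/-- The right action `a · u` of the subalgebra `A'` on `A`, the `A`-component of the product. -/
def rightAct (a : A) (u : A') : A := (Q.mul (a, 0) (0, u)).1

/-- The multiplication of the subalgebra `A'`. -/
def subMul (u v : A') : A' := (Q.mul (0, u) (0, v)).2

theorem mul_inr_inr (u v : A') : Q.mul (0, u) (0, v) = (0, Q.subMul u v) :=
  Prod.ext (Q.mul_right_mem u v) rfl

theorem fst_mul_inr_left (u : A') (b : A × A') : (Q.mul (0, u) b).1 = Q.leftAct u b.1 := by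
  have split : b = (b.1, 0) + (0, b.2) := by simp
  rw [split, map_add, Prod.fst_add, Q.mul_right_mem, add_zero, leftAct, Prod.fst_add, add_zero]

theorem fst_mul_inr_right (a : A × A') (v : A') : (Q.mul a (0, v)).1 = Q.rightAct a.1 v := by
  have split : a = (a.1, 0) + (0, a.2) := by simp
  rw [split, map_add, LinearMap.add_apply, Prod.fst_add, Q.mul_right_mem, add_zero, rightAct,
    Prod.fst_add, add_zero]

variable {p q : ℕ} (f : Cochain K A A' p) (g : Cochain K A A' q)

theorem delta_eq_lof : Q.delta
    = DirectSum.lof K ℕ (Cochain K (A × A') (A × A')) 1 (bilinearCochain Q.mul) := rfl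

/-- The signed sum of the terms `f(…, g(s_i, …, s_{i+q}) · s_{i+q+1}, …)`. -/
def leftActInsertions (s : ℕ → A) : A' :=
  ∑ i ∈ Finset.range (p + 1), (-1 : ℤ) ^ (i * (q + 1)) •
    evalSeq f (insertSeq i (q + 1) (Q.leftAct (evalSeq g fun k => s (i + k)) (s (i + (q + 1)))) s)

/-- The signed sum of the terms `f(…, s_i · g(s_{i+1}, …, s_{i+q+1}), …)`. -/
def rightActInsertions (s : ℕ → A) : A' :=
  ∑ i ∈ Finset.range (p + 1), (-1 : ℤ) ^ (i * (q + 1)) •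
    evalSeq f (insertSeq i (q + 1) (Q.rightAct (s i) (evalSeq g fun k => s (i + (1 + k)))) s)

/-- The value of the derived bracket `[[Ω, f]_G, g]_G` of lifted cochains, a lift again. -/
def explicitBracket (s : ℕ → A) : A' :=
  (-1 : ℤ) ^ p • Q.subMul (evalSeq g s) (evalSeq f fun k => s (1 + q + k))
    + (-1 : ℤ) ^ (p * q + q) • Q.subMul (evalSeq f s) (evalSeq g fun k => s (1 + p + k))
    - (-1 : ℤ) ^ p • (Q.leftActInsertions f g s + (-1 : ℤ) ^ q • Q.rightActInsertions f g s)
    - (-1 : ℤ) ^ ((1 + p) * q) •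
      (Q.leftActInsertions g f s + (-1 : ℤ) ^ p • Q.rightActInsertions g f s)

theorem evalSeq_liftCochain_gerstenhaberComp_mul_liftCochain (s : ℕ → A × A') :
    evalSeq (gerstenhaberComp p (1 + q) (liftCochain f)
        (gerstenhaberComp 1 q (bilinearCochain Q.mul) (liftCochain g))) s
      = (0, Q.leftActInsertions f g (fun k => (s k).1)
          + (-1 : ℤ) ^ q • Q.rightActInsertions f g fun k => (s k).1) := by
  rw [evalSeq_liftCochain_gerstenhaberComp, leftActInsertions, rightActInsertions, Finset.smul_sum,
    ← Finset.sum_add_distrib]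
  refine congrArg (Prod.mk 0) (Finset.sum_congr rfl fun i hi => ?_)
  rw [Finset.mem_range] at hi
  simp only [evalSeq_bilinearCochain_gerstenhaberComp, evalSeq_liftCochain, Prod.fst_add,
    Prod.smul_fst, fst_mul_inr_left, fst_mul_inr_right, evalSeq_insertSeq_add hi,
    evalSeq_insertSeq hi, map_zsmul, smul_add, add_comm 1 q, add_zero]
  rw [smul_comm]

theorem evalSeq_mul_gerstenhaberComp_liftCochain_liftCochain (s : ℕ → A × A') :
    evalSeq (gerstenhaberComp (1 + p) q (gerstenhaberComp 1 p (bilinearCochain Q.mul)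
        (liftCochain f)) (liftCochain g)) s
      = (0, (-1 : ℤ) ^ p • Q.subMul (evalSeq g fun k => (s k).1)
            (evalSeq f fun k => (s (1 + q + k)).1)
          + (-1 : ℤ) ^ (p * q + q) • Q.subMul (evalSeq f fun k => (s k).1)
            (evalSeq g fun k => (s (1 + p + k)).1)) := by
  rw [evalSeq_gerstenhaberComp_assoc,
    liftCochain_gerstenhaberComp_eq_zero f fun s => congrArg Prod.fst (evalSeq_liftCochain g s),
    disjointInsertions_bilinearCochain, disjointInsertions_bilinearCochain]
  simp only [evalSeq_liftCochain, mul_inr_inr, smul_smul, ← pow_add, map_zero]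
  ext <;> simp [evalSeq]

end ExplicitFormula

section DerivedBracket

variable {i j : ℤ} {x y : Cochains K A A'}

theorem delta_mem : Q.delta ∈ cochainGrading K (A × A') (A × A') 1 :=
  lof_mem_cochainGrading Nat.cast_one _

theorem delta_cochainsComp_delta : Q.delta ⋆ Q.delta = 0 := by
  rw [delta_eq_lof, cochainsComp_lof]
  refine (congrArg _ (evalSeq_injective (funext fun s => ?_))).trans (map_zero _)
  rw [evalSeq_bilinearCochain_gerstenhaberComp]
  simp only [evalSeq_bilinearCochain, Q.mul_assoc, pow_one, neg_one_smul]
  exact add_neg_cancel _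

theorem bracket_bracket_delta_eq (hx : x ∈ cochainGrading K A A' i)
    (hy : y ∈ cochainGrading K A A' j) :
    ⁅⁅Q.delta, cochainLift K A A' x⁆_G, cochainLift K A A' y⁆_G
      = Q.delta ⋆ cochainLift K A A' x ⋆ cochainLift K A A' y
        - (i.negOnePow : ℤ) • (cochainLift K A A' x ⋆ (Q.delta ⋆ cochainLift K A A' y))
        - (((1 + i) * j).negOnePow : ℤ) •
          (cochainLift K A A' y ⋆ (Q.delta ⋆ cochainLift K A A' x)) := by
  have hX := cochainLift_mem hx
  have hY := cochainLift_mem hy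
  have assoc := cochainsComp_preLie hX Q.delta_mem hY
  rw [cochainLift_cochainsComp_cochainLift hx hy, map_zero, LinearMap.zero_apply,
    cochainLift_cochainsComp_cochainLift_cochainsComp hx hy Q.delta_mem, sub_zero, smul_zero,
    sub_eq_zero] at assoc
  rw [gerstenhaberBracket_eq (gerstenhaberBracket_mem Q.delta_mem hX) hY,
    gerstenhaberBracket_eq Q.delta_mem hX, one_mul]
  simp only [map_sub, map_zsmul, LinearMap.sub_apply, LinearMap.smul_apply, assoc,
    cochainLift_cochainsComp_cochainLift_cochainsComp hy hx Q.delta_mem, smul_zero, sub_zero]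

theorem componentEval_bracket_bracket_delta {p q : ℕ} (f : Cochain K A A' p) (g : Cochain K A A' q)
    (N : ℕ) (s : ℕ → A × A') :
    componentEval N s
        ⁅⁅Q.delta, cochainLift K A A' (DirectSum.lof K ℕ (Cochain K A A') p f)⁆_G,
          cochainLift K A A' (DirectSum.lof K ℕ (Cochain K A A') q g)⁆_G
      = (0, if p + q + 1 = N then Q.explicitBracket f g fun k => (s k).1 else 0) := by
  rw [Q.bracket_bracket_delta_eq (lof_mem_cochainGrading rfl f) (lof_mem_cochainGrading rfl g),
    delta_eq_lof, cochainLift_lof, cochainLift_lof]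
  simp only [cochainsComp_lof, map_sub, map_zsmul, componentEval_lof]
  by_cases h : p + q + 1 = N
  · rw [if_pos (by omega), if_pos (by omega), if_pos (by omega), if_pos h,
      evalSeq_mul_gerstenhaberComp_liftCochain_liftCochain,
      evalSeq_liftCochain_gerstenhaberComp_mul_liftCochain,
      evalSeq_liftCochain_gerstenhaberComp_mul_liftCochain, explicitBracket,
      show (1 + (p : ℤ)) * q = ((1 + p) * q : ℕ) by push_cast; rfl]
    simp only [Int.coe_negOnePow_natCast]
    ext <;> simp
  · rw [if_neg (by omega), if_neg (by omega), if_neg (by omega), if_neg h]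
    ext <;> simp

/-- The curvature `P Ω` of the derived brackets. -/
def curvature : Cochains K A A' := cochainProj K A A' Q.delta

/-- The unary derived bracket `P [Ω, f]_G`. -/
def differential : Cochains K A A' →ₗ[K] Cochains K A A' :=
  cochainProj K A A' ∘ₗ gerstenhaberBracket K (A × A') Q.delta ∘ₗ cochainLift K A A'

theorem differential_apply (x : Cochains K A A') :
    Q.differential x = cochainProj K A A' ⁅Q.delta, cochainLift K A A' x⁆_G := rfl

/-- The binary derived bracket `P [[Ω, f]_G, g]_G`. -/
def bracket : Cochains K A A' →ₗ[K] Cochains K A A' →ₗ[K] Cochains K A A' :=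
  ((gerstenhaberBracket K (A × A') ∘ₗ gerstenhaberBracket K (A × A') Q.delta ∘ₗ
    cochainLift K A A').compl₂ (cochainLift K A A')).compr₂ (cochainProj K A A')

theorem bracket_apply (x y : Cochains K A A') :
    Q.bracket x y
      = cochainProj K A A' ⁅⁅Q.delta, cochainLift K A A' x⁆_G, cochainLift K A A' y⁆_G := rfl

theorem componentEval_bracket {p q : ℕ} (f : Cochain K A A' p) (g : Cochain K A A' q) (N : ℕ)
    (s : ℕ → A) :
    componentEval N s (Q.bracket (DirectSum.lof K ℕ (Cochain K A A') p f)
        (DirectSum.lof K ℕ (Cochain K A A') q g))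
      = if p + q + 1 = N then Q.explicitBracket f g s else 0 := by
  rw [bracket_apply, componentEval_cochainProj, componentEval_bracket_bracket_delta]

theorem cochainLift_bracket (x y : Cochains K A A') :
    cochainLift K A A' (Q.bracket x y)
      = ⁅⁅Q.delta, cochainLift K A A' x⁆_G, cochainLift K A A' y⁆_G := by
  have bilinear_eq : Q.bracket.compr₂ (cochainLift K A A')
      = (gerstenhaberBracket K (A × A') ∘ₗ gerstenhaberBracket K (A × A') Q.delta ∘ₗ
        cochainLift K A A').compl₂ (cochainLift K A A') := by
    refine cochains_bilinear_ext fun p q f g => cochains_ext fun N s => ?_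
    simp only [LinearMap.compr₂_apply, LinearMap.compl₂_apply, LinearMap.comp_apply,
      componentEval_cochainLift, componentEval_bracket, componentEval_bracket_bracket_delta]
  exact LinearMap.congr_fun₂ bilinear_eq x y

theorem iteratedBracket_succ (k : ℕ) (x : Fin (k + 1) → Cochains K A A') :
    Q.iteratedBracket (k + 1) x
      = ⁅Q.iteratedBracket k (Fin.init x), cochainLift K A A' (x (Fin.last k))⁆_G := rfl

theorem iteratedBracket_add_three (k : ℕ) : Q.iteratedBracket (k + 3) = 0 := by
  refine MultilinearMap.ext fun x => ?_
  induction k with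
  | zero =>
    have two_eq (y : Fin 2 → Cochains K A A') :
        Q.iteratedBracket 2 y = cochainLift K A A' (Q.bracket (y 0) (y 1)) :=
      (Q.cochainLift_bracket _ _).symm
    rw [iteratedBracket_succ, two_eq, gerstenhaberBracket_cochainLift_cochainLift]
    rfl
  | succ k ih =>
    rw [iteratedBracket_succ, ih, zero_apply, map_zero]
    rfl

theorem derivedBracket_eq_quadraticOps :
    Q.derivedBracket = quadraticOps Q.curvature Q.differential Q.bracket := by
  funext k
  match k with
  | 0 => rfl
  | 1 => rfl
  | 2 => rfl
  | k + 3 =>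
    refine MultilinearMap.ext fun x => ?_
    rw [derivedBracket, iteratedBracket_add_three]
    exact map_zero (cochainProj K A A')

end DerivedBracket

theorem differential_eq_zero (fst_mul_inl : ∀ a b : A, (Q.mul (a, 0) (b, 0)).1 = 0)
    (snd_mul_inr_inl : ∀ (u : A') (a : A), (Q.mul (0, u) (a, 0)).2 = 0)
    (snd_mul_inl_inr : ∀ (a : A) (u : A'), (Q.mul (a, 0) (0, u)).2 = 0) : Q.differential = 0 := by
  refine DirectSum.linearMap_ext K fun n => LinearMap.ext fun f => cochains_ext fun N s => ?_
  have lift_comp_mul (s : ℕ → A) :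
      evalSeq (gerstenhaberComp n 1 (liftCochain f) (bilinearCochain Q.mul)) (fun k => (s k, 0))
        = 0 := by
    rw [evalSeq_liftCochain_gerstenhaberComp, Finset.sum_eq_zero, Prod.mk_zero_zero]
    intro i hi
    rw [evalSeq_bilinearCochain, fst_mul_inl, evalSeq_insertSeq_zero (Finset.mem_range.1 hi),
      smul_zero]
  rw [LinearMap.comp_apply, LinearMap.comp_apply, LinearMap.zero_apply, map_zero,
    Q.differential_apply, componentEval_cochainProj, cochainLift_lof,
    gerstenhaberBracket_eq Q.delta_mem (lof_mem_cochainGrading rfl _), Q.delta_eq_lof,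
    cochainsComp_lof, cochainsComp_lof, map_sub, map_zsmul, componentEval_lof, componentEval_lof,
    evalSeq_bilinearCochain_gerstenhaberComp, evalSeq_liftCochain, evalSeq_liftCochain,
    lift_comp_mul]
  split_ifs <;> simp [snd_mul_inr_inl, snd_mul_inl_inr]

section CurvedLie

variable {i j k : ℤ} {x y z : Cochains K A A'}

theorem bracket_delta_mem (hx : x ∈ cochainGrading K A A' i) :
    ⁅Q.delta, cochainLift K A A' x⁆_G ∈ cochainGrading K (A × A') (A × A') (1 + i) :=
  gerstenhaberBracket_mem Q.delta_mem (cochainLift_mem hx)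

theorem curvature_mem : Q.curvature ∈ cochainGrading K A A' 1 :=
  cochainProj_mem Q.delta_mem

theorem differential_mem (hx : x ∈ cochainGrading K A A' i) :
    Q.differential x ∈ cochainGrading K A A' (i + 1) :=
  add_comm 1 i ▸ cochainProj_mem (Q.bracket_delta_mem hx)

theorem bracket_mem (hx : x ∈ cochainGrading K A A' i) (hy : y ∈ cochainGrading K A A' j) :
    Q.bracket x y ∈ cochainGrading K A A' (i + j + 1) := by
  rw [add_comm (i + j), ← add_assoc]
  exact cochainProj_mem (gerstenhaberBracket_mem (Q.bracket_delta_mem hx) (cochainLift_mem hy))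

theorem bracket_symm (hx : x ∈ cochainGrading K A A' i) (hy : y ∈ cochainGrading K A A' j) :
    Q.bracket y x = ((i * j).negOnePow : ℤ) • Q.bracket x y := by
  have jacobi := gerstenhaberBracket_jacobi Q.delta_mem (cochainLift_mem hy) (cochainLift_mem hx)
  rw [gerstenhaberBracket_cochainLift_cochainLift, map_zero] at jacobi
  rw [bracket_apply, bracket_apply, ← map_zsmul, mul_comm, ← sub_eq_zero, ← map_sub, ← jacobi,
    map_zero]

theorem differential_curvature : Q.differential Q.curvature = 0 := by
  have proj_sq := cochainProj_cochainsComp Q.delta_mem Q.delta_mem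
  rw [delta_cochainsComp_delta, map_zero] at proj_sq
  rw [differential_apply, gerstenhaberBracket_eq Q.delta_mem (cochainLift_mem Q.curvature_mem),
    curvature, mul_one, Int.negOnePow_one, Units.val_neg, Units.val_one, neg_one_smul,
    sub_neg_eq_add, map_add, ← proj_sq]

theorem cochainProj_bracket_cochainLift_bracket_delta (hx : x ∈ cochainGrading K A A' i)
    (hy : y ∈ cochainGrading K A A' j) :
    cochainProj K A A' ⁅cochainLift K A A' y, ⁅Q.delta, cochainLift K A A' x⁆_G⁆_G
      = -(j.negOnePow : ℤ) • Q.bracket y x := by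
  rw [gerstenhaberBracket_antisymm (cochainLift_mem hy) (Q.bracket_delta_mem hx), map_zsmul,
    ← bracket_apply, Q.bracket_symm hx hy, mul_add, mul_one, mul_comm j, Int.negOnePow_add]
  push_cast
  rcases coe_negOnePow_eq_one_or_neg_one (i * j) with h | h <;> rw [h] <;> module

theorem bracket_curvature_add_differential_differential (hx : x ∈ cochainGrading K A A' i) :
    Q.bracket Q.curvature x + Q.differential (Q.differential x) = 0 := by
  have sq_zero := congrArg (cochainProj K A A') (gerstenhaberBracket_bracket_self_of_sq_eq_zero
    Q.delta_mem odd_one (cochainLift_mem hx) Q.delta_cochainsComp_delta)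
  rw [cochainProj_gerstenhaberBracket Q.delta_mem (Q.bracket_delta_mem hx), ← curvature,
    Q.cochainProj_bracket_cochainLift_bracket_delta hx Q.curvature_mem, ← differential_apply,
    ← differential_apply, map_zero] at sq_zero
  simpa only [Int.negOnePow_one, Units.val_neg, Units.val_one, neg_neg, one_smul] using sq_zero

theorem bracket_delta_cochainLift_bracket (hx : x ∈ cochainGrading K A A' i)
    (hy : y ∈ cochainGrading K A A' j) :
    ⁅Q.delta, cochainLift K A A' (Q.bracket x y)⁆_G
      = -(((1 + i) * j).negOnePow : ℤ) •
        ⁅⁅Q.delta, cochainLift K A A' y⁆_G, ⁅Q.delta, cochainLift K A A' x⁆_G⁆_G := by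
  rw [cochainLift_bracket,
    gerstenhaberBracket_jacobi Q.delta_mem (Q.bracket_delta_mem hx) (cochainLift_mem hy),
    gerstenhaberBracket_bracket_self_of_sq_eq_zero Q.delta_mem odd_one (cochainLift_mem hx)
      Q.delta_cochainsComp_delta, map_zero, LinearMap.zero_apply, zero_sub, neg_smul]

theorem differential_bracket (hx : x ∈ cochainGrading K A A' i)
    (hy : y ∈ cochainGrading K A A' j) :
    Q.differential (Q.bracket x y) + Q.bracket (Q.differential x) y
      + ((i * j).negOnePow : ℤ) • Q.bracket (Q.differential y) x = 0 := by
  rw [differential_apply, Q.bracket_delta_cochainLift_bracket hx hy, map_zsmul,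
    cochainProj_gerstenhaberBracket (Q.bracket_delta_mem hy) (Q.bracket_delta_mem hx),
    ← differential_apply, ← differential_apply, ← bracket_apply,
    Q.cochainProj_bracket_cochainLift_bracket_delta hx (Q.differential_mem hy),
    Q.bracket_symm (Q.differential_mem hx) hy]
  simp only [add_mul, one_mul, Int.negOnePow_add, Int.negOnePow_one]
  push_cast
  rcases coe_negOnePow_eq_one_or_neg_one j with hj | hj <;>
    rcases coe_negOnePow_eq_one_or_neg_one (i * j) with hij | hij <;>
      rw [hj, hij] <;> module

theorem bracket_jacobi (hx : x ∈ cochainGrading K A A' i) (hy : y ∈ cochainGrading K A A' j)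
    (hz : z ∈ cochainGrading K A A' k) :
    Q.bracket (Q.bracket x y) z + ((j * k).negOnePow : ℤ) • Q.bracket (Q.bracket x z) y
      + ((i * (j + k)).negOnePow : ℤ) • Q.bracket (Q.bracket y z) x = 0 := by
  have jacobi := congrArg (cochainProj K A A') (gerstenhaberBracket_jacobi
    (Q.bracket_delta_mem hy) (Q.bracket_delta_mem hx) (cochainLift_mem hz))
  rw [map_sub, map_zsmul, ← cochainLift_bracket (x := x), ← bracket_apply, ← cochainLift_bracket,
    Q.cochainProj_bracket_cochainLift_bracket_delta hx (Q.bracket_mem hy hz),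
    Q.bracket_symm (Q.bracket_mem hx hz) hy, eq_sub_iff_add_eq] at jacobi
  rw [bracket_apply _ (Q.bracket x y), Q.bracket_delta_cochainLift_bracket hx hy, map_zsmul,
    LinearMap.smul_apply, map_zsmul, ← jacobi]
  simp only [add_mul, mul_add, one_mul, mul_comm k j, Int.negOnePow_add, Int.negOnePow_one]
  push_cast
  rcases coe_negOnePow_eq_one_or_neg_one j with hj | hj <;>
    rcases coe_negOnePow_eq_one_or_neg_one k with hk | hk <;>
      rcases coe_negOnePow_eq_one_or_neg_one (i * j) with hij | hij <;>
        rcases coe_negOnePow_eq_one_or_neg_one (i * k) with hik | hik <;>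
          rcases coe_negOnePow_eq_one_or_neg_one (j * k) with hjk | hjk <;>
            rw [hj, hk, hij, hik, hjk] <;> module

theorem isShiftedCurvedDGLie :
    IsShiftedCurvedDGLie (cochainGrading K A A') Q.curvature Q.differential Q.bracket where
  graded := isInternal_cochainGrading
  curvature_mem := Q.curvature_mem
  differential_mem := Q.differential_mem
  bracket_mem := Q.bracket_mem
  bracket_symm := Q.bracket_symm
  bianchi := Q.differential_curvature
  differential_sq := Q.bracket_curvature_add_differential_differential
  leibniz := Q.differential_bracket
  jacobi := Q.bracket_jacobi

theorem isCurvedLInfty_derivedBracket :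
    IsCurvedLInfty (cochainGrading K A A') Q.derivedBracket :=
  Q.derivedBracket_eq_quadraticOps ▸ Q.isShiftedCurvedDGLie.isCurvedLInfty_quadraticOps

end CurvedLie

end QuasiTwilledAlgebra

section ModifiedSum

variable {K : Type*} [Field K] {A : Type*} [NonUnitalRing A] [Module K A]

theorem apply_window {n : ℕ} (f : Cochain K A A n) (x : ℕ → A) (a : ℕ) :
    f (window x a (n + 1)) = evalSeq f fun k => x (a + k) := rfl

theorem apply_replaceBlock {n : ℕ} (f : Cochain K A A n) (x : ℕ → A) (i r : ℕ) (a : A) :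
    f (replaceBlock x (i + 1) a r (n + 1)) = evalSeq f (insertSeq i r a fun k => x (1 + k)) := by
  refine congrArg f (funext fun k => ?_)
  simp only [replaceBlock, insertSeq, Nat.add_lt_add_iff_right, Nat.add_right_cancel_iff]
  split_ifs <;> first | rfl | (congr 1; omega)

theorem sum_Icc_one_eq_sum_range {M : Type*} [AddCommMonoid M] (m : ℕ) (F : ℕ → M) :
    ∑ i ∈ Finset.Icc 1 m, F i = ∑ i ∈ Finset.range m, F (i + 1) := by
  rw [Finset.range_eq_Ico, Finset.sum_Ico_add' F 0 m 1]
  rfl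

variable [IsScalarTower K A A] [SMulCommClass K A A] (lam : K)

theorem curvature_sumM : (sumM A lam).curvature
    = DirectSum.lof K ℕ (Cochain K A A) 1 (bilinearCochain (lam • LinearMap.mul K A)) := by
  rw [QuasiTwilledAlgebra.curvature, QuasiTwilledAlgebra.delta_eq_lof, cochainProj_lof]
  refine congrArg _ (evalSeq_injective (funext fun s => ?_))
  simp [evalSeq_projCochain, evalSeq_bilinearCochain, sumM]

theorem differential_sumM : (sumM A lam).differential = 0 :=
  (sumM A lam).differential_eq_zero (fun _ _ => by simp [sumM]) (fun _ _ => by simp [sumM])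
    fun _ _ => by simp [sumM]

theorem leftAct_sumM (u a : A) : (sumM A lam).leftAct u a = u * a := by
  simp [QuasiTwilledAlgebra.leftAct, sumM]

theorem rightAct_sumM (a u : A) : (sumM A lam).rightAct a u = a * u := by
  simp [QuasiTwilledAlgebra.rightAct, sumM]

theorem subMul_sumM (u v : A) : (sumM A lam).subMul u v = u * v := by
  simp [QuasiTwilledAlgebra.subMul, sumM]

variable {p q : ℕ} (f : Cochain K A A p) (g : Cochain K A A q) (x : ℕ → A)

theorem sum_replaceBlock_eq_leftActInsertions (c : ℤ) :
    ∑ i ∈ Finset.Icc 1 (p + 1), ((-1 : ℤ) ^ ((i - 1) * (q + 1)) * c) •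
        f (replaceBlock x i (g (window x i (q + 1)) * x (i + (q + 1))) (q + 1) (p + 1))
      = c • (sumM A lam).leftActInsertions f g fun k => x (1 + k) := by
  rw [sum_Icc_one_eq_sum_range, QuasiTwilledAlgebra.leftActInsertions, Finset.smul_sum]
  refine Finset.sum_congr rfl fun i _ => ?_
  rw [apply_replaceBlock, apply_window, leftAct_sumM, Nat.add_sub_cancel, smul_smul, mul_comm c]
  simp only [← add_assoc, add_comm 1 i]

theorem sum_replaceBlock_eq_rightActInsertions (c : ℤ) :
    ∑ i ∈ Finset.Icc 1 (p + 1), ((-1 : ℤ) ^ ((i - 1) * (q + 1)) * c) •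
        f (replaceBlock x i (x i * g (window x (i + 1) (q + 1))) (q + 1) (p + 1))
      = c • (sumM A lam).rightActInsertions f g fun k => x (1 + k) := by
  rw [sum_Icc_one_eq_sum_range, QuasiTwilledAlgebra.rightActInsertions, Finset.smul_sum]
  refine Finset.sum_congr rfl fun i _ => ?_
  rw [apply_replaceBlock, apply_window, rightAct_sumM, Nat.add_sub_cancel, smul_smul, mul_comm c]
  simp only [← add_assoc, add_comm 1 i]

theorem explicitBracket_sumM :
    (sumM A lam).explicitBracket f g (fun k => x (1 + k)) = explicitL2 f g x := by
  have shift : ∑ i ∈ Finset.Icc 1 (p + 1), ((-1 : ℤ) ^ (i * (q + 1)) * (-1) ^ (p + 1)) •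
        f (replaceBlock x i (x i * g (window x (i + 1) (q + 1))) (q + 1) (p + 1))
      = (-1 : ℤ) ^ (p + q) • (sumM A lam).rightActInsertions f g fun k => x (1 + k) := by
    rw [← sum_replaceBlock_eq_rightActInsertions]
    refine Finset.sum_congr rfl fun i hi => ?_
    obtain ⟨i, rfl⟩ := Nat.exists_eq_add_of_le' (Finset.mem_Icc.1 hi).1
    rw [Nat.add_sub_cancel]
    congr 1
    ring
  rw [explicitL2, shift, sum_replaceBlock_eq_leftActInsertions lam,
    sum_replaceBlock_eq_leftActInsertions lam, sum_replaceBlock_eq_rightActInsertions lam,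
    QuasiTwilledAlgebra.explicitBracket, subMul_sumM, subMul_sumM, Nat.add_sub_cancel,
    Nat.add_sub_cancel]
  have reindex (r : ℕ) : (fun k => x (r + 1 + 1 + k)) = fun k => x (1 + (1 + r + k)) :=
    funext fun k => congrArg x (by omega)
  simp only [apply_window, reindex, mul_add, add_mul, pow_add, mul_one, one_mul, pow_one]
  rcases neg_one_pow_eq_or ℤ p with hp | hp <;> rcases neg_one_pow_eq_or ℤ q with hq | hq <;>
    rcases neg_one_pow_eq_or ℤ (p * q) with hpq | hpq <;> rw [hp, hq, hpq] <;> module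

end ModifiedSum

section MaurerCartan

variable {K : Type*} [Field K] {A : Type*} [NonUnitalRing A] [Module K A]

theorem explicitL2_linearMap (D : A →ₗ[K] A) (x : ℕ → A) :
    explicitL2 (MultilinearMap.ofSubsingleton K A A (0 : Fin 1) D)
      (MultilinearMap.ofSubsingleton K A A (0 : Fin 1) D) x
      = (2 : K) • (D (x 1) * D (x 2) - D (x 1 * D (x 2)) - D (D (x 1) * x 2)) := by
  simp only [explicitL2, zero_add, tsub_self, pow_zero, pow_one, mul_zero, mul_one, one_smul,
    Finset.Icc_self, Finset.sum_singleton, window, replaceBlock, lt_self_iff_false,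
    ↓reduceIte, Fin.val_eq_zero, add_zero, Nat.reduceAdd, MultilinearMap.ofSubsingleton_apply_apply]
  module

variable [IsScalarTower K A A] [SMulCommClass K A A] (lam : K)

theorem derivedBracket_sumM_eq_quadraticOps :
    (sumM A lam).derivedBracket
      = quadraticOps (sumM A lam).curvature 0 (sumM A lam).bracket := by
  rw [QuasiTwilledAlgebra.derivedBracket_eq_quadraticOps, differential_sumM]

theorem derivedBracket_zero_sumM_apply (x y : A) :
    (sumM A lam).derivedBracket 0 ![] 1 ![x, y] = lam • (x * y) := by
  change (sumM A lam).curvature 1 ![x, y] = lam • (x * y)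
  rw [curvature_sumM, DirectSum.lof_apply]
  rfl

theorem derivedBracket_two_sumM_apply_window {p q : ℕ} (f : Cochain K A A p) (g : Cochain K A A q)
    (x : ℕ → A) :
    (sumM A lam).derivedBracket 2
      ![DirectSum.lof K ℕ (Cochain K A A) p f, DirectSum.lof K ℕ (Cochain K A A) q g]
      (p + q + 1) (window x 1 (p + q + 1 + 1)) = explicitL2 f g x := by
  rw [← explicitBracket_sumM lam]
  exact ((sumM A lam).componentEval_bracket f g _ fun k => x (1 + k)).trans (if_pos rfl)

theorem componentEval_curvature_add_bracket_sumM (h2 : (2 : K) ≠ 0) (D : A →ₗ[K] A) (N : ℕ)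
    (x : ℕ → A) :
    componentEval N (fun k => x (1 + k)) ((sumM A lam).curvature
        + (2 : K)⁻¹ • (sumM A lam).bracket
          (DirectSum.lof K ℕ (Cochain K A A) 0
            (MultilinearMap.ofSubsingleton K A A (0 : Fin 1) D))
          (DirectSum.lof K ℕ (Cochain K A A) 0
            (MultilinearMap.ofSubsingleton K A A (0 : Fin 1) D)))
      = if 1 = N then lam • (x 1 * x 2)
          + (D (x 1) * D (x 2) - D (x 1 * D (x 2)) - D (D (x 1) * x 2)) else 0 := by
  rw [map_add, map_smul, curvature_sumM, componentEval_lof,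
    QuasiTwilledAlgebra.componentEval_bracket, explicitBracket_sumM, explicitL2_linearMap,
    evalSeq_bilinearCochain, zero_add, zero_add]
  split_ifs
  · rw [inv_smul_smul₀ h2]
    rfl
  · rw [smul_zero, add_zero]

theorem isMaurerCartan_sumM_iff {x : Cochains K A A} :
    IsMaurerCartan (cochainGrading K A A) (sumM A lam).derivedBracket x ↔
      x ∈ cochainGrading K A A 0 ∧
        (sumM A lam).curvature + (2 : K)⁻¹ • (sumM A lam).bracket x x = 0 := by
  rw [derivedBracket_sumM_eq_quadraticOps, isMaurerCartan_quadraticOps_iff, LinearMap.zero_apply,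
    zero_add]

theorem isMaurerCartan_sumM_lof_iff (h2 : (2 : K) ≠ 0) (D : A →ₗ[K] A) :
    IsMaurerCartan (cochainGrading K A A) (sumM A lam).derivedBracket
      (DirectSum.lof K ℕ (Cochain K A A) 0
        (MultilinearMap.ofSubsingleton K A A (0 : Fin 1) D)) ↔ IsModifiedRotaBaxter lam D := by
  rw [isMaurerCartan_sumM_iff, and_iff_right (lof_mem_cochainGrading Nat.cast_zero _)]
  constructor
  · intro mc a b
    have value := componentEval_curvature_add_bracket_sumM lam h2 D 1
      fun k => if k = 1 then a else b
    rw [mc, map_zero, if_pos rfl] at value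
    exact eq_neg_of_add_eq_zero_right value.symm
  · intro hD
    refine cochains_ext fun N s => ?_
    have value := componentEval_curvature_add_bracket_sumM lam h2 D N fun k => s (k - 1)
    simp only [Nat.add_sub_cancel_left] at value
    rw [value, hD, add_neg_cancel, ite_self, map_zero]

end MaurerCartan

theorem mainTheorem3 {K : Type*} [Field K] {A : Type*} [NonUnitalRing A] [Module K A]
    [IsScalarTower K A A] [SMulCommClass K A A] (lam : K) :
    -- the derived brackets of `A ⊕_M A` form a curved `L_∞`-algebra
    IsCurvedLInfty (cochainGrading K A A) (sumM A lam).derivedBracket ∧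
    -- `l_0(x, y) = λ x y`
    (∀ x y : A, (sumM A lam).derivedBracket 0 ![] 1 ![x, y] = lam • (x * y)) ∧
    -- `l_1 = 0`
    (sumM A lam).derivedBracket 1 = 0 ∧
    -- the explicit formula for `l_2` on `f ∈ Hom(⊗^{p+1} A, A)` and `g ∈ Hom(⊗^{q+1} A, A)`,
    -- evaluated at `(x_1, …, x_{(p+1)+(q+1)})`
    (∀ (p q : ℕ) (f : Cochain K A A p) (g : Cochain K A A q) (x : ℕ → A),
      (sumM A lam).derivedBracket 2
        ![DirectSum.lof K ℕ (Cochain K A A) p f, DirectSum.lof K ℕ (Cochain K A A) q g]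
        (p + q + 1) (window x 1 (p + q + 1 + 1)) = explicitL2 f g x) ∧
    -- there are no further operations
    (∀ k : ℕ, 3 ≤ k → (sumM A lam).derivedBracket k = 0) ∧
    -- the Maurer-Cartan elements are exactly the modified Rota-Baxter operators of weight `λ`,
    -- a linear map `D : A → A` being regarded as an element of `Hom(⊗^1 A, A)`
    ((2 : K) ≠ 0 → ∀ x : Cochains K A A,
      IsMaurerCartan (cochainGrading K A A) (sumM A lam).derivedBracket x ↔
        ∃ D : A →ₗ[K] A, IsModifiedRotaBaxter lam D ∧
          x = DirectSum.lof K ℕ (Cochain K A A) 0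
            (MultilinearMap.ofSubsingleton K A A (0 : Fin 1) D)) := by
  refine ⟨(sumM A lam).isCurvedLInfty_derivedBracket, derivedBracket_zero_sumM_apply lam, ?_,
    fun p q => derivedBracket_two_sumM_apply_window lam, fun k hk => ?_,
    fun h2 x => ⟨fun hx => ?_, ?_⟩⟩
  · rw [derivedBracket_sumM_eq_quadraticOps]
    rfl
  · obtain ⟨k, rfl⟩ := Nat.exists_eq_add_of_le' hk
    rw [derivedBracket_sumM_eq_quadraticOps]
    rfl
  · obtain ⟨D, rfl⟩ := exists_eq_lof_ofSubsingleton_of_mem_cochainGrading_zero hx.1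
    exact ⟨D, (isMaurerCartan_sumM_lof_iff lam h2 D).1 hx, rfl⟩
  · rintro ⟨D, hD, rfl⟩
    exact (isMaurerCartan_sumM_lof_iff lam h2 D).2 hD
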